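/- Let $A$ be a non-empty finite set of actions, and write $[n]=\{1,\dots,n\}$. A *rightward open MDP* (roMDP) from $m$ to $n$ ($m,n\in\mathbb N$) consists of a finite set $Q$ of positions, an entry function $E:[m]\to Q+[n]$, transition probabilities $P:Q\times A\times(Q+[n])\to\mathbb R_{\ge0}$ with $\sum_{t}P(s,a,t)\in\{0,1\}$ for all $s\in Q$, $a\in A$, and a reward function $R:Q\to\mathbb R_{\ge0}$, such that each exit $t\in[n]$ is accessed by at most one element of $[m]+Q$ (an entrance $i$ accesses $t$ if $E(i)=t$; a position $s$ accesses $t$ if $P(s,a,t)>0$ for some $a$) and from a position by at most one action. An isomorphism of roMDPs from $m$ to $n$ is a bijection of positions preserving $E$, $P$, $R$ (with the exits fixed). Arrows $m\to n$ of $\mathbf{roMDP}$ are roMDPs from $m$ to $n$ modulo isomorphism, with the following operations. The identity $\mathcal I_m:m\to m$ and the swap $\mathcal S_{m,n}:m+n\to n+m$ have no positions, and $E(i)=i$, respectively $E(i)=i+n$ for $i\le m$ and $E(i)=i-m$ for $i>m$. For $\mathcal A:m\to k$ and $\mathcal B:k\to n$, the sequential composition $\mathcal A;\mathcal B:m\to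 n$ has positions $Q^{\mathcal A}+Q^{\mathcal B}$ and redirects each exit $i\in[k]$ of $\mathcal A$ to $E^{\mathcal B}(i)$ (adding up probabilities). The sum $\mathcal A\oplus\mathcal B:m+k\to n+l$ of $\mathcal A:m\to n$ and $\mathcal B:k\to l$ is their disjoint juxtaposition. The trace $\mathrm{tr}_l(\mathcal A):m\to n$ of $\mathcal A:l+m\to l+n$ has the positions and rewards of $\mathcal A$, and each of the first $l$ exits is fed back into the entrance with the same number, repeatedly, until a position or one of the last $n$ exits is reached (adding up probabilities). The category $\mathbf{oMDP}=\mathrm{Int}(\mathbf{roMDP})$ has as objects the pairs $X=(X_r,X_l)$ of natural numbers; an arrow $X\to Y$ is an arrow $X_r+Y_l\to Y_r+X_l$ of $\mathbf{roMDP}$; the identity of $X$ is $\mathcal I_{X_r+X_l}$; the composite of $\mathcal A:X\to Y$ and $\mathcal B:Y\to Z$ is $$\mathcal A;\mathcal B:=\mathrm{tr}_{Y_l}\big((\mathcal S_{Y_l,X_r}\oplus\mathcal I_{Z_l});(\mathcal A\oplus\mathcal I_{Z_l});(\mathcal I_{Y_r}\oplus\mathcal S_{X_l,Z_l});(\mathcal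 B\oplus\mathcal I_{X_l});(\mathcal S_{Z_r,Y_l}\oplus\mathcal I_{X_l})\big).$$ On objects $X\oplus Y:=(X_r+Y_r,\,Y_l+X_l)$, and for arrows $\mathcal A:X\to Y$ and $\mathcal B:Z\to W$, $$\mathcal A\oplus\mathcal B:=(\mathcal S_{X_r,Z_r}\oplus\mathcal S_{W_l,Y_l});(\mathcal I_{Z_r}\oplus\mathcal A\oplus\mathcal I_{W_l});(\mathcal S_{Z_r,Y_r}\oplus\mathcal S_{X_l,W_l});(\mathcal I_{Y_r}\oplus\mathcal B\oplus\mathcal I_{X_l}).$$ **Theorem.** $\mathbf{oMDP}$, equipped with $;$ and $\oplus$, is a compact closed category. That is: with these identities and $;$ it is a category; with $\oplus$, unit object $(0,0)$ and identities as associators and unitors it is a (strict) monoidal category, symmetric with the braiding $\mathcal S_{X_r,Y_r}\oplus\mathcal S_{X_l,Y_l}:X\oplus Y\to Y\oplus X$; and every object has a left and a right dual, a dual of $X$ being $X^*=(X_l,X_r)$ with unit $\mathcal I_{X_r+X_l}:(0,0)\to X\oplus X^*$ and counit $\mathcal I_{X_l+X_r}:X^*\oplus X\to(0,0)$. -/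

import Mathlib

open CategoryTheory MonoidalCategory
open scoped NNReal

universe u

/-! ## Rightward open MDPs -/

/-- The set of exits that are immediately reachable from an entrance (in `I`) or from a
position (in `Q`), for an entry function `E` and transition probabilities `P`. -/
def exitsOf {A : Type u} {I J Q : Type} (E : I → Q ⊕ J) (P : Q → A → Q ⊕ J → ℝ≥0) :
    I ⊕ Q → Set J
  | .inl i => {t | E i = .inr t}
  | .inr s => {t | ∃ a, 0 < P s a (.inr t)}

/-- A rightward open MDP over the action set `A`, with entrances `I` and exits `J`.
A rightward open MDP from `m` to `n` is the case `I = Fin m`, `J = Fin n`. -/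
structure RoMDP (A : Type u) (I J : Type) [Fintype J] where
  /-- positions -/
  Q : Type
  /-- there are finitely many positions -/
  [fintypeQ : Fintype Q]
  /-- entry function -/
  E : I → Q ⊕ J
  /-- transition probabilities -/
  P : Q → A → Q ⊕ J → ℝ≥0
  /-- reward function -/
  R : Q → ℝ≥0
  sum_P : ∀ s a, ∑ t, P s a t = 0 ∨ ∑ t, P s a t = 1
  /-- each exit is accessed from at most one entrance or position -/
  unique_access : ∀ x y : I ⊕ Q, (exitsOf E P x ∩ exitsOf E P y).Nonempty → x = y
  /-- each exit is reached from a position by at most one action -/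
  unique_action : ∀ (t : J) (s : Q) (a b : A), 0 < P s a (.inr t) → 0 < P s b (.inr t) → a = b

namespace RoMDP

attribute [instance] RoMDP.fintypeQ

section Iso

variable {A : Type u} {I J : Type} [Fintype J]

/-- An isomorphism of rightward open MDPs: a bijection between the positions that preserves
entry function, transition probabilities and rewards (and is the identity on the exits). -/
structure Iso (M N : RoMDP A I J) where
  /-- the bijection between positions -/
  η : M.Q ≃ N.Q
  map_E : ∀ i, Sum.map η id (M.E i) = N.E i
  map_P : ∀ s a t, M.P s a t = N.P (η s) a (Sum.map η id t)
  map_R : ∀ s, M.R s = N.R (η s)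

theorem Iso.map_symm_E {M N : RoMDP A I J} (f : Iso M N) (i : I) :
    Sum.map f.η.symm id (N.E i) = M.E i := by
  rw [← f.map_E i]; cases M.E i <;> simp

/-- Two rightward open MDPs are identified when they are isomorphic. -/
instance setoid (A : Type u) (I J : Type) [Fintype J] : Setoid (RoMDP A I J) where
  r M N := Nonempty (Iso M N)
  iseqv :=
    { refl := fun M => ⟨⟨Equiv.refl _, fun i => by simp, fun s a t => by simp, fun s => rfl⟩⟩
      symm := by
        rintro M N ⟨f⟩
        refine ⟨⟨f.η.symm, f.map_symm_E, fun s a t => ?_, fun s => by simp [f.map_R]⟩⟩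
        rw [f.map_P]; cases t <;> simp
      trans := by
        rintro M N K ⟨f⟩ ⟨g⟩
        refine ⟨⟨f.η.trans g.η, fun i => ?_, fun s a t => ?_, fun s => ?_⟩⟩
        · rw [← g.map_E, ← f.map_E]; cases M.E i <;> simp
        · rw [f.map_P, g.map_P]; cases t <;> simp
        · rw [f.map_R, g.map_R]; rfl }

end Iso

/-! ### Operations on rightward open MDPs -/

/-- The unique-access condition, split into its three cases. -/
theorem unique_access_of {A : Type u} {I J Q : Type} {E : I → Q ⊕ J} {P : Q → A → Q ⊕ J → ℝ≥0}
    (h₁ : ∀ i i' t, E i = .inr t → E i' = .inr t → i = i')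
    (h₂ : ∀ i s a t, E i = .inr t → 0 < P s a (.inr t) → False)
    (h₃ : ∀ s s' a a' t, 0 < P s a (.inr t) → 0 < P s' a' (.inr t) → s = s') :
    ∀ x y : I ⊕ Q, (exitsOf E P x ∩ exitsOf E P y).Nonempty → x = y := by
  rintro (i | s) (i' | s') ⟨t, h, h'⟩
  · exact congrArg _ (h₁ i i' t h h')
  · obtain ⟨a, h'⟩ := h'
    exact (h₂ _ _ _ _ h h').elim
  · obtain ⟨a, h⟩ := h
    exact (h₂ _ _ _ _ h' h).elim
  · obtain ⟨a, h⟩ := h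
    obtain ⟨a', h'⟩ := h'
    exact congrArg _ (h₃ _ _ _ _ _ h h')

section Ops

variable {A : Type u} {I I' J J' K L : Type}
  [Fintype J] [Fintype J'] [Fintype K] [Fintype L]

theorem eq_of_entry_entry (M : RoMDP A I J) {i i' : I} {t : J}
    (h : M.E i = .inr t) (h' : M.E i' = .inr t) : i = i' :=
  Sum.inl_injective (M.unique_access (.inl i) (.inl i') ⟨t, h, h'⟩)

theorem not_entry_pos (M : RoMDP A I J) {i : I} {s : M.Q} {a : A} {t : J}
    (h : M.E i = .inr t) (h' : 0 < M.P s a (.inr t)) : False :=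
  Sum.inl_ne_inr (M.unique_access (.inl i) (.inr s) ⟨t, h, a, h'⟩)

theorem eq_of_pos_pos (M : RoMDP A I J) {s s' : M.Q} {a a' : A} {t : J}
    (h : 0 < M.P s a (.inr t)) (h' : 0 < M.P s' a' (.inr t)) : s = s' :=
  Sum.inr_injective (M.unique_access (.inr s) (.inr s') ⟨t, ⟨a, h⟩, ⟨a', h'⟩⟩)

/-- The rightward open MDP without positions in which each entrance `i` goes directly to the
exit `e i`. -/
def wire (A : Type u) (e : I ≃ J) : RoMDP A I J where
  Q := Empty
  E i := .inr (e i)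
  P s := s.elim
  R s := s.elim
  sum_P s := s.elim
  unique_access := unique_access_of
    (fun _ _ _ h h' => e.injective (Sum.inr_injective (h.trans h'.symm)))
    (fun _ s => s.elim) (fun s => s.elim)
  unique_action _ s := s.elim

/-- Renaming of entrances and exits along bijections. -/
def reindex (e : I ≃ I') (f : J ≃ J') (M : RoMDP A I J) : RoMDP A I' J' where
  Q := M.Q
  E i := Sum.map id f (M.E (e.symm i))
  P s a t := M.P s a (Sum.map id f.symm t)
  R := M.R
  sum_P s a := by
    have : ∑ t, M.P s a (Sum.map id f.symm t) = ∑ t, M.P s a t := by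
      simp [Fintype.sum_sum_type, Equiv.sum_comp f.symm (fun t => M.P s a (.inr t))]
    rw [this]; exact M.sum_P s a
  unique_access := by
    have key : ∀ i t, Sum.map (id : M.Q → M.Q) f (M.E (e.symm i)) = .inr t →
        M.E (e.symm i) = .inr (f.symm t) := by
      intro i t h
      cases hE : M.E (e.symm i) with
      | inl q => simp [hE] at h
      | inr j => simp [hE] at h; simp [← h]
    exact unique_access_of
      (fun _ _ _ h h' => e.symm.injective (M.eq_of_entry_entry (key _ _ h) (key _ _ h')))
      (fun i s a t h h' => M.not_entry_pos (key _ _ h) h')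
      (fun s s' a a' t h h' => M.eq_of_pos_pos h h')
  unique_action t s a b h h' := M.unique_action _ s a b h h'

theorem reindex_congr (e : I ≃ I') (f : J ≃ J') {M N : RoMDP A I J} (h : M ≈ N) :
    M.reindex e f ≈ N.reindex e f := by
  obtain ⟨g⟩ := h
  refine ⟨⟨g.η, fun i => ?_, fun s a t => (g.map_P s a _).trans ?_, g.map_R⟩⟩
  · change Sum.map g.η id (Sum.map id f (M.E (e.symm i))) = Sum.map id f (N.E (e.symm i))
    rw [← g.map_E]; cases M.E (e.symm i) <;> rfl
  · cases t <;> rfl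

/-- Entry function of the sequential composition. -/
def seqE (M : RoMDP A I K) (N : RoMDP A K J) (i : I) : (M.Q ⊕ N.Q) ⊕ J :=
  match M.E i with
  | .inl q => .inl (.inl q)
  | .inr k => Sum.map .inr id (N.E k)

open Classical in
/-- Transition probabilities of the sequential composition. -/
noncomputable def seqP (M : RoMDP A I K) (N : RoMDP A K J) :
    M.Q ⊕ N.Q → A → (M.Q ⊕ N.Q) ⊕ J → ℝ≥0
  | .inl s, a, .inl (.inl q) => M.P s a (.inl q)
  | .inl s, a, .inl (.inr q) => ∑ k, M.P s a (.inr k) * if N.E k = .inl q then 1 else 0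
  | .inl s, a, .inr j => ∑ k, M.P s a (.inr k) * if N.E k = .inr j then 1 else 0
  | .inr _, _, .inl (.inl _) => 0
  | .inr s, a, .inl (.inr q) => N.P s a (.inl q)
  | .inr s, a, .inr j => N.P s a (.inr j)

theorem seqE_eq_inr {M : RoMDP A I K} {N : RoMDP A K J} {i : I} {t : J}
    (h : seqE M N i = .inr t) : ∃ k, M.E i = .inr k ∧ N.E k = .inr t := by
  unfold seqE at h
  cases hE : M.E i with
  | inl q => simp [hE] at h
  | inr k =>
    refine ⟨k, rfl, ?_⟩
    cases hN : N.E k with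
    | inl q => simp [hE, hN] at h
    | inr j => simpa [hE, hN] using h

theorem seqP_pos {M : RoMDP A I K} {N : RoMDP A K J} {s : M.Q} {a : A} {t : J}
    (h : 0 < seqP M N (.inl s) a (.inr t)) :
    ∃ k, 0 < M.P s a (.inr k) ∧ N.E k = .inr t := by
  classical
  obtain ⟨k, -, hk⟩ := Finset.exists_ne_zero_of_sum_ne_zero (by exact h.ne')
  by_cases hN : N.E k = .inr t
  · exact ⟨k, by simpa [hN, pos_iff_ne_zero] using hk, hN⟩
  · simp [hN] at hk

/-- Sequential composition of rightward open MDPs. -/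
noncomputable def seq (M : RoMDP A I K) (N : RoMDP A K J) : RoMDP A I J where
  Q := M.Q ⊕ N.Q
  E := seqE M N
  P := seqP M N
  R := Sum.elim M.R N.R
  sum_P := by
    classical
    rintro (s | s) a
    · have : ∑ t, seqP M N (.inl s) a t = ∑ t, M.P s a t := by
        simp only [Fintype.sum_sum_type, seqP, add_assoc]
        congr 1
        rw [Finset.sum_comm, Finset.sum_comm (s := (Finset.univ : Finset J)),
          ← Finset.sum_add_distrib]
        refine Finset.sum_congr rfl fun k _ => ?_
        cases N.E k <;> simp
      rw [this]; exact M.sum_P s a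
    · have : ∑ t, seqP M N (.inr s) a t = ∑ t, N.P s a t := by
        simp [Fintype.sum_sum_type, seqP]
      rw [this]; exact N.sum_P s a
  unique_access := by
    refine unique_access_of ?_ ?_ ?_
    · intro i i' t h h'
      obtain ⟨k, hk, hk'⟩ := seqE_eq_inr h
      obtain ⟨l, hl, hl'⟩ := seqE_eq_inr h'
      obtain rfl := N.eq_of_entry_entry hk' hl'
      exact M.eq_of_entry_entry hk hl
    · rintro i (s | s) a t h h'
      · obtain ⟨k, hk, hk'⟩ := seqE_eq_inr h
        obtain ⟨l, hl, hl'⟩ := seqP_pos h'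
        obtain rfl := N.eq_of_entry_entry hk' hl'
        exact M.not_entry_pos hk hl
      · obtain ⟨k, hk, hk'⟩ := seqE_eq_inr h
        exact N.not_entry_pos hk' h'
    · rintro (s | s) (s' | s') a a' t h h'
      · obtain ⟨k, hk, hk'⟩ := seqP_pos h
        obtain ⟨l, hl, hl'⟩ := seqP_pos h'
        obtain rfl := N.eq_of_entry_entry hk' hl'
        exact congrArg _ (M.eq_of_pos_pos hk hl)
      · obtain ⟨k, hk, hk'⟩ := seqP_pos h
        exact (N.not_entry_pos hk' h').elim
      · obtain ⟨k, hk, hk'⟩ := seqP_pos h'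
        exact (N.not_entry_pos hk' h).elim
      · exact congrArg _ (N.eq_of_pos_pos h h')
  unique_action := by
    rintro t (s | s) a b h h'
    · obtain ⟨k, hk, hk'⟩ := seqP_pos h
      obtain ⟨l, hl, hl'⟩ := seqP_pos h'
      obtain rfl := N.eq_of_entry_entry hk' hl'
      exact M.unique_action k s a b hk hl
    · exact N.unique_action t s a b h h'

theorem seq_congr {M M' : RoMDP A I K} (h : M ≈ M') {N N' : RoMDP A K J} (h' : N ≈ N') :
    M.seq N ≈ M'.seq N' := by
  classical
  obtain ⟨f⟩ := h
  obtain ⟨g⟩ := h'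
  refine ⟨⟨Equiv.sumCongr f.η g.η, fun i => ?_, ?_, ?_⟩⟩
  · change Sum.map (Sum.map f.η g.η) id (seqE M N i) = seqE M' N' i
    simp only [seqE, ← f.map_E]
    cases M.E i with
    | inl q => rfl
    | inr k => simp only [Sum.map_inr, id, ← g.map_E]; cases N.E k <;> rfl
  · have hl : ∀ k q, N'.E k = .inl (g.η q) ↔ N.E k = .inl q := by
      intro k q; rw [← g.map_E]; cases N.E k <;> simp
    have hr : ∀ k j, N'.E k = .inr j ↔ N.E k = .inr j := by
      intro k q; rw [← g.map_E]; cases N.E k <;> simp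
    change ∀ s a t, seqP M N s a t =
      seqP M' N' (Sum.map f.η g.η s) a (Sum.map (Sum.map f.η g.η) id t)
    rintro (s | s) a ((q | q) | j) <;> simp [seqP, f.map_P, g.map_P, hl, hr]
  · rintro (s | s)
    · exact f.map_R s
    · exact g.map_R s

/-- Transition probabilities of the sum. -/
def sumP (M : RoMDP A I J) (N : RoMDP A I' J') :
    M.Q ⊕ N.Q → A → (M.Q ⊕ N.Q) ⊕ (J ⊕ J') → ℝ≥0
  | .inl s, a, .inl (.inl q) => M.P s a (.inl q)
  | .inl s, a, .inr (.inl j) => M.P s a (.inr j)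
  | .inr s, a, .inl (.inr q) => N.P s a (.inl q)
  | .inr s, a, .inr (.inr j) => N.P s a (.inr j)
  | _, _, _ => 0

theorem map_eq_inr_iff {α β γ δ : Type} {f : α → γ} {g : β → δ} {x : α ⊕ β} {y : δ} :
    Sum.map f g x = .inr y ↔ ∃ b, x = .inr b ∧ g b = y := by
  cases x <;> simp

/-- Sum of rightward open MDPs: put them side by side. -/
def sum (M : RoMDP A I J) (N : RoMDP A I' J') : RoMDP A (I ⊕ I') (J ⊕ J') where
  Q := M.Q ⊕ N.Q
  E := Sum.elim (fun i => Sum.map .inl .inl (M.E i)) (fun i => Sum.map .inr .inr (N.E i))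
  P := sumP M N
  R := Sum.elim M.R N.R
  sum_P := by
    rintro (s | s) a
    · simpa [Fintype.sum_sum_type, sumP] using M.sum_P s a
    · simpa [Fintype.sum_sum_type, sumP] using N.sum_P s a
  unique_access := by
    refine unique_access_of ?_ ?_ ?_
    · rintro (i | i) (i' | i') (t | t) h h' <;>
        simp only [Sum.elim_inl, Sum.elim_inr, map_eq_inr_iff, Sum.inl.injEq, Sum.inr.injEq,
          exists_eq_right, reduceCtorEq, and_false, exists_false] at h h'
      · exact congrArg _ (M.eq_of_entry_entry h h')
      · exact congrArg _ (N.eq_of_entry_entry h h')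
    · rintro (i | i) (s | s) a (t | t) h h' <;>
        simp only [Sum.elim_inl, Sum.elim_inr, map_eq_inr_iff, Sum.inl.injEq, Sum.inr.injEq,
          exists_eq_right, reduceCtorEq, and_false, exists_false, sumP, lt_self_iff_false] at h h'
      · exact M.not_entry_pos h h'
      · exact N.not_entry_pos h h'
    · rintro (s | s) (s' | s') a a' (t | t) h h' <;> simp only [sumP, lt_self_iff_false] at h h'
      · exact congrArg _ (M.eq_of_pos_pos h h')
      · exact congrArg _ (N.eq_of_pos_pos h h')
  unique_action := by
    rintro (t | t) (s | s) a b h h' <;> simp only [sumP, lt_self_iff_false] at h h'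
    · exact M.unique_action t s a b h h'
    · exact N.unique_action t s a b h h'

theorem sum_congr {M M' : RoMDP A I J} (h : M ≈ M') {N N' : RoMDP A I' J'} (h' : N ≈ N') :
    M.sum N ≈ M'.sum N' := by
  obtain ⟨f⟩ := h
  obtain ⟨g⟩ := h'
  refine ⟨⟨Equiv.sumCongr f.η g.η, ?_, ?_, ?_⟩⟩
  · rintro (i | i)
    · change Sum.map (Sum.map f.η g.η) id (Sum.map Sum.inl Sum.inl (M.E i)) =
        Sum.map Sum.inl Sum.inl (M'.E i)
      rw [← f.map_E]; cases M.E i <;> rfl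
    · change Sum.map (Sum.map f.η g.η) id (Sum.map Sum.inr Sum.inr (N.E i)) =
        Sum.map Sum.inr Sum.inr (N'.E i)
      rw [← g.map_E]; cases N.E i <;> rfl
  · change ∀ s a t, sumP M N s a t =
      sumP M' N' (Sum.map f.η g.η s) a (Sum.map (Sum.map f.η g.η) id t)
    rintro (s | s) a ((q | q) | (j | j)) <;> simp [sumP, f.map_P, g.map_P]
  · rintro (s | s)
    · exact f.map_R s
    · exact g.map_R s

/-! The trace. The open ends in `L` are fed back. -/

/-- `M.Leads x t`: a token put on the entrance `x`, and put back on the entrance `l` each time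
it comes out at a looping exit `l ∈ L`, eventually leaves the loop at the position or
non-looping exit `t`. -/
inductive Leads (M : RoMDP A (L ⊕ I) (L ⊕ J)) : L ⊕ I → M.Q ⊕ J → Prop
  | pos {x : L ⊕ I} {q : M.Q} (h : M.E x = .inl q) : Leads M x (.inl q)
  | exit {x : L ⊕ I} {j : J} (h : M.E x = .inr (.inr j)) : Leads M x (.inr j)
  | loop {x : L ⊕ I} {l : L} {t : M.Q ⊕ J} (h : M.E x = .inr (.inl l))
      (h' : Leads M (.inl l) t) : Leads M x t

theorem Leads.unique {M : RoMDP A (L ⊕ I) (L ⊕ J)} {x : L ⊕ I} {t t' : M.Q ⊕ J}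
    (h : M.Leads x t) (h' : M.Leads x t') : t = t' := by
  induction h with
  | pos h => cases h' <;> simp_all
  | exit h => cases h' <;> simp_all
  | loop h _ ih =>
    cases h' with
    | pos h' => simp_all
    | exit h' => simp_all
    | loop h' h'' =>
      obtain rfl : _ = _ := by simpa using h.symm.trans h'
      exact ih h''

/-- A looping open end that is not reached from a looping entrance leads somewhere. -/
theorem exists_leads_of_not_loop (M : RoMDP A (L ⊕ I) (L ⊕ J)) (l : L)
    (hl : ∀ l', M.E (.inl l') ≠ .inr (.inl l)) : ∃ t, M.Leads (.inl l) t := by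
  by_contra hS
  have next : ∀ x : {l : L // ¬ ∃ t, M.Leads (.inl l) t},
      ∃ y : {l : L // ¬ ∃ t, M.Leads (.inl l) t}, M.E (.inl x.1) = .inr (.inl y.1) := by
    rintro ⟨x, hx⟩
    rcases hE : M.E (.inl x) with q | (l' | j)
    · exact (hx ⟨_, .pos hE⟩).elim
    · exact ⟨⟨l', fun ⟨t, ht⟩ => hx ⟨t, .loop hE ht⟩⟩, by simp⟩
    · exact (hx ⟨_, .exit hE⟩).elim
  choose f hf using next
  have hinj : Function.Injective f := by
    intro x y hxy
    have := hf x
    rw [hxy] at this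
    exact Subtype.ext (Sum.inl_injective (M.eq_of_entry_entry this (hf y)))
  obtain ⟨y, hy⟩ := Finite.surjective_of_injective hinj ⟨l, hS⟩
  exact hl y.1 (by rw [hf y, hy])

theorem exists_leads (M : RoMDP A (L ⊕ I) (L ⊕ J)) (i : I) : ∃ t, M.Leads (.inr i) t := by
  rcases hE : M.E (.inr i) with q | (l | j)
  · exact ⟨_, .pos hE⟩
  · obtain ⟨t, ht⟩ := M.exists_leads_of_not_loop l
      (fun l' h => Sum.inl_ne_inr (M.eq_of_entry_entry h hE))
    exact ⟨t, .loop hE ht⟩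
  · exact ⟨_, .exit hE⟩

theorem exists_leads_of_pos (M : RoMDP A (L ⊕ I) (L ⊕ J)) {s : M.Q} {a : A} {l : L}
    (h : 0 < M.P s a (.inr (.inl l))) : ∃ t, M.Leads (.inl l) t :=
  M.exists_leads_of_not_loop l (fun _ h' => M.not_entry_pos h' h)

/-- `M.Step x y`: a token put on the entrance `x` comes out at a looping exit and is put back
on the entrance `y`. -/
def Step (M : RoMDP A (L ⊕ I) (L ⊕ J)) (x y : L ⊕ I) : Prop :=
  ∃ l, y = .inl l ∧ M.E x = .inr (.inl l)

theorem Leads.exists_last {M : RoMDP A (L ⊕ I) (L ⊕ J)} {x : L ⊕ I} {t : M.Q ⊕ J} {j : J}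
    (h : M.Leads x t) (ht : t = .inr j) :
    ∃ y, Relation.ReflTransGen M.Step x y ∧ M.E y = .inr (.inr j) := by
  induction h with
  | pos h => simp at ht
  | exit h =>
    obtain rfl : _ = _ := by simpa using ht
    exact ⟨_, .refl, h⟩
  | loop h _ ih =>
    obtain ⟨y, hy, hy'⟩ := ih ht
    exact ⟨y, .head ⟨_, rfl, h⟩ hy, hy'⟩

/-- Two open ends that lead to the same exit and are not reached from entrances agree. -/
theorem Leads.eq_of_exit {M : RoMDP A (L ⊕ I) (L ⊕ J)} {x y : L ⊕ I} {j : J}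
    (hx : M.Leads x (.inr j)) (hy : M.Leads y (.inr j))
    (hx' : ∀ z, ¬ M.Step z x) (hy' : ∀ z, ¬ M.Step z y) : x = y := by
  obtain ⟨x₁, h₁, h₂⟩ := hx.exists_last rfl
  obtain ⟨y₁, h₃, h₄⟩ := hy.exists_last rfl
  obtain rfl := M.eq_of_entry_entry h₂ h₄
  have hU : Relator.RightUnique (Function.swap M.Step) := by
    rintro a b c ⟨l, hl, hb⟩ ⟨l', hl', hc⟩
    obtain rfl : l = l' := Sum.inl_injective (hl.symm.trans hl')
    exact M.eq_of_entry_entry hb hc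
  rcases Relation.ReflTransGen.total_of_right_unique hU
    (Relation.reflTransGen_swap.2 h₁) (Relation.reflTransGen_swap.2 h₃) with h | h
  · rcases h.cases_head with h | ⟨z, hz, -⟩
    · exact h
    · exact (hx' z hz).elim
  · rcases h.cases_head with h | ⟨z, hz, -⟩
    · exact h.symm
    · exact (hy' z hz).elim

theorem not_step_of_pos {M : RoMDP A (L ⊕ I) (L ⊕ J)} {s : M.Q} {a : A} {l : L}
    (h : 0 < M.P s a (.inr (.inl l))) (z : L ⊕ I) : ¬ M.Step z (.inl l) := by
  rintro ⟨l', hl, hz⟩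
  obtain rfl : l = l' := Sum.inl_injective hl
  exact M.not_entry_pos hz h

theorem not_step_inr {M : RoMDP A (L ⊕ I) (L ⊕ J)} (i : I) (z : L ⊕ I) :
    ¬ M.Step z (.inr i) := by
  rintro ⟨l', hl, -⟩
  simp at hl

open Classical in
/-- The looping open ends that eventually enter `M` at the position or exit `t`. -/
noncomputable def prec (M : RoMDP A (L ⊕ I) (L ⊕ J)) (t : M.Q ⊕ J) : Finset L :=
  Finset.univ.filter fun l => M.Leads (.inl l) t

/-- Transition probabilities of the trace. -/
noncomputable def traceP (M : RoMDP A (L ⊕ I) (L ⊕ J)) (s : M.Q) (a : A) (t : M.Q ⊕ J) : ℝ≥0 :=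
  M.P s a (Sum.map id .inr t) + ∑ l ∈ M.prec t, M.P s a (.inr (.inl l))

theorem traceP_pos {M : RoMDP A (L ⊕ I) (L ⊕ J)} {s : M.Q} {a : A} {j : J}
    (h : 0 < M.traceP s a (.inr j)) :
    0 < M.P s a (.inr (.inr j)) ∨ ∃ l, 0 < M.P s a (.inr (.inl l)) ∧ M.Leads (.inl l) (.inr j) := by
  by_contra! hc
  have h0 : M.P s a (.inr (.inr j)) = 0 := nonpos_iff_eq_zero.1 hc.1
  have h1 : ∑ l ∈ M.prec (.inr j), M.P s a (.inr (.inl l)) = 0 := by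
    refine Finset.sum_eq_zero fun l hl => ?_
    by_contra h2
    exact hc.2 l (pos_iff_ne_zero.2 h2) (by simpa [prec] using hl)
  simp [traceP, h0, h1] at h

/-- An exit that an open end leads to is not accessed directly from a position. -/
theorem not_direct_of_leads {M : RoMDP A (L ⊕ I) (L ⊕ J)} {x : L ⊕ I} {s : M.Q} {a : A} {j : J}
    (hx : M.Leads x (.inr j)) (h : 0 < M.P s a (.inr (.inr j))) : False := by
  obtain ⟨y, -, hy⟩ := hx.exists_last rfl
  exact M.not_entry_pos hy h

/-- Trace of a rightward open MDP. -/
noncomputable def trace (M : RoMDP A (L ⊕ I) (L ⊕ J)) : RoMDP A I J where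
  Q := M.Q
  E i := (M.exists_leads i).choose
  P := M.traceP
  R := M.R
  sum_P s a := by
    classical
    have : ∑ t, M.traceP s a t = ∑ t, M.P s a t := by
      have h1 : ∑ t, ∑ l ∈ M.prec t, M.P s a (.inr (.inl l)) = ∑ l, M.P s a (.inr (.inl l)) := by
        simp only [prec, Finset.sum_filter]
        rw [Finset.sum_comm]
        refine Finset.sum_congr rfl fun l _ => ?_
        rcases eq_or_ne (M.P s a (.inr (.inl l))) 0 with h0 | h0
        · simp [h0]
        · obtain ⟨t, ht⟩ := M.exists_leads_of_pos (pos_iff_ne_zero.2 h0)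
          rw [Finset.sum_eq_single t (fun t' _ ht' => if_neg fun h => ht' (h.unique ht))
            (fun h => (h (Finset.mem_univ _)).elim), if_pos ht]
      simp only [traceP, Finset.sum_add_distrib, h1]
      simp only [Fintype.sum_sum_type, Sum.map_inl, Sum.map_inr, id]
      ring
    rw [this]; exact M.sum_P s a
  unique_access := by
    refine unique_access_of ?_ ?_ ?_
    · intro i i' t h h'
      have h₁ := (M.exists_leads i).choose_spec
      have h₂ := (M.exists_leads i').choose_spec
      rw [h] at h₁
      rw [h'] at h₂
      exact Sum.inr_injective (h₁.eq_of_exit h₂ (not_step_inr i) (not_step_inr i'))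
    · intro i s a t h h'
      have h₁ := (M.exists_leads i).choose_spec
      rw [h] at h₁
      rcases traceP_pos h' with h₂ | ⟨l, hl, hl'⟩
      · exact not_direct_of_leads h₁ h₂
      · exact Sum.inr_ne_inl (h₁.eq_of_exit hl' (not_step_inr i) (not_step_of_pos hl))
    · intro s s' a a' t h h'
      rcases traceP_pos h with h₁ | ⟨l, hl, hl'⟩ <;> rcases traceP_pos h' with h₂ | ⟨k, hk, hk'⟩
      · exact M.eq_of_pos_pos h₁ h₂
      · exact (not_direct_of_leads hk' h₁).elim
      · exact (not_direct_of_leads hl' h₂).elim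
      · obtain rfl := Sum.inl_injective
          (hl'.eq_of_exit hk' (not_step_of_pos hl) (not_step_of_pos hk))
        exact M.eq_of_pos_pos hl hk
  unique_action := by
    intro t s a b h h'
    rcases traceP_pos h with h₁ | ⟨l, hl, hl'⟩ <;> rcases traceP_pos h' with h₂ | ⟨k, hk, hk'⟩
    · exact M.unique_action _ s a b h₁ h₂
    · exact (not_direct_of_leads hk' h₁).elim
    · exact (not_direct_of_leads hl' h₂).elim
    · obtain rfl := Sum.inl_injective
        (hl'.eq_of_exit hk' (not_step_of_pos hl) (not_step_of_pos hk))
      exact M.unique_action _ s a b hl hk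

theorem Leads.map {M N : RoMDP A (L ⊕ I) (L ⊕ J)} (f : Iso M N) {x : L ⊕ I} {t : M.Q ⊕ J}
    (h : M.Leads x t) : N.Leads x (Sum.map f.η id t) := by
  induction h with
  | pos h => exact .pos (by rw [← f.map_E, h]; rfl)
  | exit h => exact .exit (by rw [← f.map_E, h]; rfl)
  | loop h _ ih => exact .loop (by rw [← f.map_E, h]; rfl) ih

theorem leads_map_iff {M N : RoMDP A (L ⊕ I) (L ⊕ J)} (f : Iso M N) {x : L ⊕ I}
    {t : M.Q ⊕ J} (hx : ∃ t', M.Leads x t') : N.Leads x (Sum.map f.η id t) ↔ M.Leads x t := by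
  refine ⟨fun h => ?_, fun h => h.map f⟩
  obtain ⟨t', ht'⟩ := hx
  have := (ht'.map f).unique h
  rwa [← Sum.map_injective.2 ⟨f.η.injective, Function.injective_id⟩ this]

theorem traceP_map {M N : RoMDP A (L ⊕ I) (L ⊕ J)} (f : Iso M N) (s : M.Q) (a : A)
    (t : M.Q ⊕ J) : M.traceP s a t = N.traceP (f.η s) a (Sum.map f.η id t) := by
  classical
  have h1 : ∑ l ∈ M.prec t, M.P s a (.inr (.inl l)) =
      ∑ l ∈ N.prec (Sum.map f.η id t), N.P (f.η s) a (.inr (.inl l)) := by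
    simp only [prec, Finset.sum_filter]
    refine Finset.sum_congr rfl fun l _ => ?_
    have h2 : N.P (f.η s) a (.inr (.inl l)) = M.P s a (.inr (.inl l)) := by
      rw [f.map_P]; rfl
    rw [h2]
    rcases eq_or_ne (M.P s a (.inr (.inl l))) 0 with h0 | h0
    · simp [h0]
    · simp only [leads_map_iff f (M.exists_leads_of_pos (pos_iff_ne_zero.2 h0))]
  rw [traceP, traceP, h1, f.map_P]
  cases t <;> rfl

theorem trace_congr {M N : RoMDP A (L ⊕ I) (L ⊕ J)} (h : M ≈ N) : M.trace ≈ N.trace := by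
  obtain ⟨f⟩ := h
  exact ⟨⟨f.η,
    fun i => ((M.exists_leads i).choose_spec.map f).unique (N.exists_leads i).choose_spec,
    traceP_map f, f.map_R⟩⟩

end Ops

end RoMDP

/-! ## The category of rightward open MDPs modulo isomorphism -/

/-- An arrow `m ⟶ n` between natural numbers: a rightward open MDP from `m` to `n`, modulo
isomorphism. -/
abbrev RoArrow (A : Type u) (m n : ℕ) : Type (max u 1) :=
  Quotient (RoMDP.setoid A (Fin m) (Fin n))

namespace RoArrow

variable {A : Type u}

/-- The identity on `m`. -/
def id (A : Type u) (m : ℕ) : RoArrow A m m :=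
  ⟦RoMDP.wire A (Equiv.refl (Fin m))⟧

/-- The swap: entrance `i < m` goes to exit `n + i`, and entrance `m + i` to exit `i`. -/
def swap (A : Type u) (m n : ℕ) : RoArrow A (m + n) (n + m) :=
  ⟦RoMDP.wire A finAddFlip⟧

/-- Sequential composition. -/
noncomputable def seq {m k n : ℕ} (f : RoArrow A m k) (g : RoArrow A k n) : RoArrow A m n :=
  Quotient.map₂ RoMDP.seq (fun _ _ h _ _ h' => RoMDP.seq_congr h h') f g

/-- Sum; the open ends of `f` come before those of `g`. -/
def sum {m n k l : ℕ} (f : RoArrow A m n) (g : RoArrow A k l) : RoArrow A (m + k) (n + l) :=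
  Quotient.map₂ (fun M N => (RoMDP.sum M N).reindex finSumFinEquiv finSumFinEquiv)
    (fun _ _ h _ _ h' => RoMDP.reindex_congr _ _ (RoMDP.sum_congr h h')) f g

/-- Trace with respect to the first `l` open ends. -/
noncomputable def trace (l : ℕ) {m n : ℕ} (f : RoArrow A (l + m) (l + n)) : RoArrow A m n :=
  Quotient.map (fun M => (M.reindex finSumFinEquiv.symm finSumFinEquiv.symm).trace)
    (fun _ _ h => RoMDP.trace_congr (RoMDP.reindex_congr _ _ h)) f

/-- Transport of an arrow along equalities of arities (such as `(l + m) + n = l + (m + n)`). -/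
def cast {m m' n n' : ℕ} (hm : m = m') (hn : n = n') (f : RoArrow A m n) : RoArrow A m' n' :=
  Quotient.map (RoMDP.reindex (finCongr hm) (finCongr hn))
    (fun _ _ h => RoMDP.reindex_congr _ _ h) f

end RoArrow

/-! ## The category of open MDPs -/

/-- Objects of the category of open MDPs over `A`: pairs of natural numbers, the numbers of
rightward and of leftward open ends. -/
@[ext]
structure OMDP (A : Type u) where
  /-- number of rightward open ends -/
  r : ℕ
  /-- number of leftward open ends -/
  l : ℕ

namespace OMDP

variable {A : Type u}

/-- Arrows from `X` to `Y` are the arrows `X.r + Y.l ⟶ Y.r + X.l` of rightward open MDPs. -/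
abbrev Arrow (X Y : OMDP A) : Type (max u 1) := RoArrow A (X.r + Y.l) (Y.r + X.l)

/-- Bidirectional sequential composition of `f : X ⟶ Y` and `g : Y ⟶ Z`, i.e.
`tr ((S ⊕ I) ; (f ⊕ I) ; (I ⊕ S) ; (g ⊕ I) ; (S ⊕ I))`, the trace being with respect to `Y.l`. -/
noncomputable def seq {X Y Z : OMDP A} (f : Arrow X Y) (g : Arrow Y Z) : Arrow X Z :=
  RoArrow.trace Y.l <|
    RoArrow.cast (Nat.add_assoc Y.l X.r Z.l) (Nat.add_assoc Y.l Z.r X.l) <|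
      ((((RoArrow.swap A Y.l X.r).sum (RoArrow.id A Z.l)).seq
        (f.sum (RoArrow.id A Z.l))).seq
        (RoArrow.cast (Nat.add_assoc Y.r X.l Z.l).symm (Nat.add_assoc Y.r Z.l X.l).symm
          ((RoArrow.id A Y.r).sum (RoArrow.swap A X.l Z.l)))).seq
        (g.sum (RoArrow.id A X.l)) |>.seq
        ((RoArrow.swap A Z.r Y.l).sum (RoArrow.id A X.l))

/-- The underlying graph of the category of open MDPs, with identities `I` and composition `;`. -/
noncomputable instance categoryStruct (A : Type u) : CategoryStruct.{max u 1} (OMDP A) where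
  Hom X Y := Arrow X Y
  id X := RoArrow.id A (X.r + X.l)
  comp f g := seq f g

/-- Sum of objects; the leftward open ends occur in reverse order. -/
def add (X Y : OMDP A) : OMDP A := ⟨X.r + Y.r, Y.l + X.l⟩

/-- The object without open ends. -/
def zero (A : Type u) : OMDP A := ⟨0, 0⟩

/-- The dual object: exchange the two directions. -/
def dual (X : OMDP A) : OMDP A := ⟨X.l, X.r⟩

/-- Bidirectional sum of `f : X ⟶ Y` and `g : Z ⟶ W`, i.e.
`(S ⊕ S) ; (I ⊕ f ⊕ I) ; (S ⊕ S) ; (I ⊕ g ⊕ I)`. -/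
noncomputable def sum {X Y Z W : OMDP A} (f : Arrow X Y) (g : Arrow Z W) :
    Arrow (X.add Z) (Y.add W) :=
  (((RoArrow.swap A X.r Z.r).sum (RoArrow.swap A W.l Y.l)).seq
    (RoArrow.cast (by omega) (by omega)
      (((RoArrow.id A Z.r).sum f).sum (RoArrow.id A W.l)))).seq
    ((RoArrow.swap A Z.r Y.r).sum (RoArrow.swap A X.l W.l)) |>.seq
    (RoArrow.cast (m' := (Y.r + Z.r) + (W.l + X.l)) (n' := (Y.r + W.r) + (Z.l + X.l))
      (by omega) (by omega) (((RoArrow.id A Y.r).sum g).sum (RoArrow.id A X.l)))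

/-- The swap `X ⊕ Y ⟶ Y ⊕ X`. -/
def swap (X Y : OMDP A) : Arrow (X.add Y) (Y.add X) :=
  (RoArrow.swap A X.r Y.r).sum (RoArrow.swap A X.l Y.l)

/-- The unit `0 ⟶ X ⊕ X*`, the identity wire on `X.r + X.l`. -/
def unit (X : OMDP A) : Arrow (zero A) (X.add X.dual) :=
  RoArrow.cast (Nat.zero_add _).symm (Nat.add_zero _).symm (RoArrow.id A (X.r + X.l))

/-- The counit `X* ⊕ X ⟶ 0`, the identity wire on `X.l + X.r`. -/
def counit (X : OMDP A) : Arrow (X.dual.add X) (zero A) :=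
  RoArrow.cast (Nat.add_zero _).symm (Nat.zero_add _).symm (RoArrow.id A (X.l + X.r))

/-- The identities and `;` satisfy the laws of a category. -/
def IsCategory (A : Type u) : Prop :=
  ∃ C : Category.{max u 1} (OMDP A), C.toCategoryStruct = categoryStruct A

/-- The category of open MDPs. -/
noncomputable abbrev category (h : IsCategory A) : Category.{max u 1} (OMDP A) where
  toCategoryStruct := categoryStruct A
  id_comp := by obtain ⟨C, hC⟩ := h; rw [← hC]; exact C.id_comp
  comp_id := by obtain ⟨C, hC⟩ := h; rw [← hC]; exact C.comp_id
  assoc := by obtain ⟨C, hC⟩ := h; rw [← hC]; exact C.assoc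

/-- The operation `⊕` on objects and arrows, with identities as associators and unitors. -/
noncomputable abbrev monoidalStruct (h : IsCategory A) :
    letI := category h
    MonoidalCategoryStruct (OMDP A) :=
  letI := category h
  { tensorObj := add
    tensorHom := fun f g => sum f g
    whiskerLeft := fun X _ _ f => sum (𝟙 X) f
    whiskerRight := fun f X => sum f (𝟙 X)
    tensorUnit := zero A
    associator := fun X Y Z => eqToIso <| by
      ext
      · exact Nat.add_assoc _ _ _
      · exact (Nat.add_assoc _ _ _).symm
    leftUnitor := fun X => eqToIso <| by
      ext
      · exact Nat.zero_add _
      · exact Nat.add_zero _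
    rightUnitor := fun X => eqToIso <| by
      ext
      · exact Nat.add_zero _
      · exact Nat.zero_add _ }

/-- The operation `⊕` satisfies the laws of a monoidal category. -/
def IsMonoidal (h : IsCategory A) : Prop :=
  letI := category h
  ∃ M : MonoidalCategory (OMDP A), M.toMonoidalCategoryStruct = monoidalStruct h

/-- The monoidal category of open MDPs. -/
noncomputable abbrev monoidal (h : IsCategory A) (hM : IsMonoidal h) :
    letI := category h
    MonoidalCategory (OMDP A) :=
  letI := category h
  { toMonoidalCategoryStruct := monoidalStruct h
    tensorHom_def := by obtain ⟨M, hM⟩ := hM; rw [← hM]; exact M.tensorHom_def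
    id_tensorHom_id := by obtain ⟨M, hM⟩ := hM; rw [← hM]; exact M.id_tensorHom_id
    tensorHom_comp_tensorHom := by
      obtain ⟨M, hM⟩ := hM; rw [← hM]; exact M.tensorHom_comp_tensorHom
    whiskerLeft_id := by obtain ⟨M, hM⟩ := hM; rw [← hM]; exact M.whiskerLeft_id
    id_whiskerRight := by obtain ⟨M, hM⟩ := hM; rw [← hM]; exact M.id_whiskerRight
    associator_naturality := by
      obtain ⟨M, hM⟩ := hM; rw [← hM]; exact M.associator_naturality
    leftUnitor_naturality := by
      obtain ⟨M, hM⟩ := hM; rw [← hM]; exact M.leftUnitor_naturality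
    rightUnitor_naturality := by
      obtain ⟨M, hM⟩ := hM; rw [← hM]; exact M.rightUnitor_naturality
    pentagon := by obtain ⟨M, hM⟩ := hM; rw [← hM]; exact M.pentagon
    triangle := by obtain ⟨M, hM⟩ := hM; rw [← hM]; exact M.triangle }

end OMDP

/-!
An arrow of the category of open MDPs is a rightward open MDP together with a partition of its
entrances and exits, and all operations only connect ends. The proof separates this combinatorics
of connections from the arithmetic of the ordinals `Fin n`.

Entrances and exits are first indexed by arbitrary finite types. There, `RoClass.close` is the
trace along explicit bijections that select the ends to be connected. The trace satisfies the
usual axioms: it commutes with sums (`RoMDP.trace_sum`), nested traces merge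
(`RoMDP.trace_trace`), it is natural and independent of the names of the loops
(`RoMDP.trace_reindex`), a sequential composition is a trace of a sum (`RoMDP.seq_equiv_trace`),
and identity wires can be removed (`RoMDP.trace_wire_sum`). The last axiom combines yanking and
naturality. All of them are proved by following a token through the feedback loops (`RoMDP.Tok`);
`RoMDP.trace_equiv` reduces an isomorphism with a trace to the entry function and the transition
probabilities.

Consequently every expression built from sums, compositions and traces is equal to a single
closing of the sum of its constituents, and two such expressions agree as soon as they connect the
same ends. This gives the compact closed category `OpenEnds A`: for instance, both sides of
associativity of `;` are closings of the sum of the same three arrows, and the zigzag identities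
for the dual are checked by following tokens through wires.

Finally, `RoArrow.split` tells the rightward and the leftward ends of an arrow of `OMDP A` apart.
By `RoArrow.split_seq` and `RoArrow.split_sum` it defines a faithful functor from `OMDP A` to
`OpenEnds A` that preserves all operations. The identities used as associators and unitors in
`OMDP A` correspond to the canonical bijections of sum types, so the laws in `OMDP A` follow from
those in `OpenEnds A`.
-/

set_option linter.unusedSectionVars false

/-! ### Renaming of ends, sums and wires -/

namespace RoMDP

section Relabelling

variable {A : Type u} {I I' I'' J J' J'' K L : Type}
  [Fintype J] [Fintype J'] [Fintype J''] [Fintype L]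

theorem reindex_refl (M : RoMDP A I J) : M.reindex (Equiv.refl I) (Equiv.refl J) ≈ M := by
  refine ⟨⟨Equiv.refl _, fun i => ?_, fun s a t => ?_, fun _ => rfl⟩⟩
  · change Sum.map id id (Sum.map id id (M.E i)) = M.E i
    simp
  · cases t <;> rfl

theorem reindex_reindex (M : RoMDP A I J) (e : I ≃ I') (f : J ≃ J') (e' : I' ≃ I'')
    (f' : J' ≃ J'') : (M.reindex e f).reindex e' f' ≈ M.reindex (e.trans e') (f.trans f') := by
  refine ⟨⟨Equiv.refl _, fun i => ?_, fun s a t => ?_, fun _ => rfl⟩⟩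
  · change Sum.map (Equiv.refl M.Q) id (Sum.map id f' (Sum.map id f _)) = Sum.map id _ (M.E _)
    simp only [Equiv.symm_trans_apply]
    cases M.E (e.symm (e'.symm i)) <;> rfl
  · cases t <;> rfl

theorem wire_reindex (e : I ≃ J) (a : I ≃ I') (b : J ≃ J') :
    (wire A e).reindex a b ≈ wire A ((a.symm.trans e).trans b) :=
  ⟨⟨Equiv.refl _, fun _ => rfl, fun s => s.elim, fun s => s.elim⟩⟩

theorem wire_sum_wire (e : I ≃ J) (f : I' ≃ J') :
    (wire A e).sum (wire A f) ≈ wire A (e.sumCongr f) := by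
  refine ⟨⟨Equiv.sumEmpty Empty Empty, ?_, ?_, ?_⟩⟩
  · rintro (i | i) <;> rfl
  · rintro (s | s) <;> exact s.elim
  · rintro (s | s) <;> exact s.elim

theorem sum_reindex (M : RoMDP A I J) (N : RoMDP A K L) {K' L' : Type} [Fintype L']
    (e : I ≃ I') (f : J ≃ J') (e' : K ≃ K') (f' : L ≃ L') :
    (M.reindex e f).sum (N.reindex e' f') ≈
      (M.sum N).reindex (e.sumCongr e') (f.sumCongr f') := by
  refine ⟨⟨Equiv.refl _, ?_, ?_, ?_⟩⟩
  · rintro (i | i)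
    · change Sum.map _ id (Sum.map Sum.inl Sum.inl (Sum.map id f (M.E (e.symm i)))) =
        Sum.map id (Sum.map f f') (Sum.map Sum.inl Sum.inl (M.E (e.symm i)))
      cases M.E (e.symm i) <;> rfl
    · change Sum.map _ id (Sum.map Sum.inr Sum.inr (Sum.map id f' (N.E (e'.symm i)))) =
        Sum.map id (Sum.map f f') (Sum.map Sum.inr Sum.inr (N.E (e'.symm i)))
      cases N.E (e'.symm i) <;> rfl
  · rintro (s | s) a ((q | q) | (j | j)) <;> rfl
  · rintro (s | s) <;> rfl

theorem sum_comm (M : RoMDP A I J) (N : RoMDP A I' J') :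
    M.sum N ≈ (N.sum M).reindex (Equiv.sumComm _ _) (Equiv.sumComm _ _) := by
  refine ⟨⟨Equiv.sumComm _ _, ?_, ?_, ?_⟩⟩
  · rintro (i | i)
    · change Sum.map Sum.swap id (Sum.map Sum.inl Sum.inl (M.E i)) =
        Sum.map id Sum.swap (Sum.map Sum.inr Sum.inr (M.E i))
      cases M.E i <;> rfl
    · change Sum.map Sum.swap id (Sum.map Sum.inr Sum.inr (N.E i)) =
        Sum.map id Sum.swap (Sum.map Sum.inl Sum.inl (N.E i))
      cases N.E i <;> rfl
  · rintro (s | s) a ((q | q) | (j | j)) <;> rfl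
  · rintro (s | s) <;> rfl

theorem sum_assoc (M : RoMDP A I J) (N : RoMDP A I' J') (O : RoMDP A I'' J'') :
    M.sum (N.sum O) ≈
      ((M.sum N).sum O).reindex (Equiv.sumAssoc _ _ _) (Equiv.sumAssoc _ _ _) := by
  refine ⟨⟨(Equiv.sumAssoc _ _ _).symm, ?_, ?_, ?_⟩⟩
  · rintro (i | i | i)
    · change Sum.map (Equiv.sumAssoc _ _ _).symm id (Sum.map Sum.inl Sum.inl (M.E i)) =
        Sum.map id (Equiv.sumAssoc _ _ _)
          (Sum.map Sum.inl Sum.inl (Sum.map Sum.inl Sum.inl (M.E i)))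
      cases M.E i <;> rfl
    · change Sum.map (Equiv.sumAssoc _ _ _).symm id
          (Sum.map Sum.inr Sum.inr (Sum.map Sum.inl Sum.inl (N.E i))) =
        Sum.map id (Equiv.sumAssoc _ _ _)
          (Sum.map Sum.inl Sum.inl (Sum.map Sum.inr Sum.inr (N.E i)))
      cases N.E i <;> rfl
    · change Sum.map (Equiv.sumAssoc _ _ _).symm id
          (Sum.map Sum.inr Sum.inr (Sum.map Sum.inr Sum.inr (O.E i))) =
        Sum.map id (Equiv.sumAssoc _ _ _) (Sum.map Sum.inr Sum.inr (O.E i))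
      cases O.E i <;> rfl
  · rintro (s | s | s) a ((q | q | q) | (j | j | j)) <;> rfl
  · rintro (s | s | s) <;> rfl

theorem sum_wire_of_isEmpty (M : RoMDP A I J) [IsEmpty K] [IsEmpty L] (e : K ≃ L) :
    M.sum (wire A e) ≈
      M.reindex (Equiv.sumEmpty I K).symm (Equiv.sumEmpty J L).symm := by
  refine ⟨⟨Equiv.sumEmpty M.Q Empty, ?_, ?_, ?_⟩⟩
  · rintro (i | i)
    · change Sum.map (Equiv.sumEmpty M.Q Empty) id (Sum.map Sum.inl Sum.inl (M.E i)) =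
        Sum.map id (Equiv.sumEmpty J L).symm (M.E i)
      cases M.E i <;> rfl
    · exact isEmptyElim i
  · rintro (s | s) a ((q | q) | (j | j))
    · rfl
    · exact q.elim
    · rfl
    · exact isEmptyElim j
    all_goals exact s.elim
  · rintro (s | s)
    · rfl
    · exact s.elim

theorem seq_wire [Fintype K] (M : RoMDP A I K) (e : K ≃ J) :
    M.seq (wire A e) ≈ M.reindex (Equiv.refl I) e := by
  classical
  refine ⟨⟨Equiv.sumEmpty M.Q Empty, fun i => ?_, ?_, ?_⟩⟩
  · change Sum.map (Equiv.sumEmpty M.Q Empty) id (seqE M (wire A e) i) = Sum.map id e (M.E i)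
    simp only [seqE]
    cases M.E i <;> rfl
  · rintro (s | s) a ((q | q) | j)
    · rfl
    · exact q.elim
    · change ∑ k, M.P s a (.inr k) * (if (.inr (e k) : Empty ⊕ J) = .inr j then 1 else 0) =
        M.P s a (.inr (e.symm j))
      simp [← Equiv.eq_symm_apply]
    all_goals exact s.elim
  · rintro (s | s)
    · rfl
    · exact s.elim

theorem wire_seq [Fintype K] (M : RoMDP A K J) (e : I ≃ K) :
    (wire A e).seq M ≈ M.reindex e.symm (Equiv.refl J) := by
  refine ⟨⟨Equiv.emptySum Empty M.Q, fun i => ?_, ?_, ?_⟩⟩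
  · change Sum.map (Equiv.emptySum Empty M.Q) id (seqE (wire A e) M i) =
      Sum.map id (Equiv.refl J) (M.E (e i))
    simp only [seqE, wire]
    cases M.E (e i) <;> rfl
  · rintro (s | s) a ((q | q) | j)
    · exact s.elim
    · exact s.elim
    · exact s.elim
    · exact q.elim
    · rfl
    · rfl
  · rintro (s | s)
    · exact s.elim
    · rfl

end Relabelling

end RoMDP

/-! ### Feedback loops and the axioms of the trace -/

namespace RoMDP

/-- `Tok E x t`: with the entry function `E` and the ends in `L` fed back, a token put on the
entrance `x` eventually leaves the loop at the position or exit `t`. This is `RoMDP.Leads`, but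
it refers to the entry function alone, so that it applies to open MDPs whose types of positions
agree by definition only. -/
inductive Tok {Q L I J : Type} (E : L ⊕ I → Q ⊕ (L ⊕ J)) : L ⊕ I → Q ⊕ J → Prop
  | pos {x : L ⊕ I} {q : Q} (h : E x = .inl q) : Tok E x (.inl q)
  | exit {x : L ⊕ I} {j : J} (h : E x = .inr (.inr j)) : Tok E x (.inr j)
  | loop {x : L ⊕ I} {l : L} {t : Q ⊕ J} (h : E x = .inr (.inl l))
      (h' : Tok E (.inl l) t) : Tok E x t

section Tokens

variable {Q L I J : Type} {E : L ⊕ I → Q ⊕ (L ⊕ J)}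

theorem Tok.unique {x : L ⊕ I} {t t' : Q ⊕ J} (h : Tok E x t) (h' : Tok E x t') : t = t' := by
  induction h with
  | pos h => cases h' <;> simp_all
  | exit h => cases h' <;> simp_all
  | loop h _ ih =>
    cases h' with
    | pos h' => simp_all
    | exit h' => simp_all
    | loop h' h'' =>
      obtain rfl : _ = _ := by simpa using h.symm.trans h'
      exact ih h''

/-- A token that leaves at once. -/
theorem Tok.of_eq {x : L ⊕ I} {t : Q ⊕ J} (h : E x = Sum.map id .inr t) : Tok E x t := by
  rcases t with q | j
  · exact .pos h
  · exact .exit h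

open Classical in
/-- The transition probabilities after the trace, when `p` gives those before. -/
noncomputable def loopProb [Fintype L] (E : L ⊕ I → Q ⊕ (L ⊕ J)) (p : Q ⊕ (L ⊕ J) → ℝ≥0)
    (t : Q ⊕ J) : ℝ≥0 :=
  p (Sum.map id .inr t) + ∑ l, if Tok E (.inl l) t then p (.inr (.inl l)) else 0

/-- If a token on the looping entrance `l` leaves at `r l`, for every `l` that is reached at all,
the probability of the looping exit `l` is added to that of `r l`. -/
theorem loopProb_eq_of_tok [Fintype L] [DecidableEq (Q ⊕ J)] {p : Q ⊕ (L ⊕ J) → ℝ≥0}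
    (r : L → Q ⊕ J) (hr : ∀ l, p (.inr (.inl l)) ≠ 0 → Tok E (.inl l) (r l)) (t : Q ⊕ J) :
    loopProb E p t = p (Sum.map id .inr t) +
      ∑ l, if r l = t then p (.inr (.inl l)) else 0 := by
  classical
  rw [loopProb]
  congr 1
  refine Finset.sum_congr rfl fun l _ => ?_
  rcases eq_or_ne (p (.inr (.inl l))) 0 with h0 | h0
  · simp [h0]
  · have h := hr l h0
    exact if_congr ⟨fun h' => h.unique h', fun h' => h' ▸ h⟩ rfl rfl

theorem loopProb_of_loop_eq_zero [Fintype L] {p : Q ⊕ (L ⊕ J) → ℝ≥0}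
    (hp : ∀ l, p (.inr (.inl l)) = 0) (t : Q ⊕ J) :
    loopProb E p t = p (Sum.map id .inr t) := by
  simp [loopProb, hp]

section Extension

variable {Q' L' I' J' : Type} {E' : L' ⊕ I' → Q' ⊕ (L' ⊕ J')} {φ : Q → Q'} {g : L → L'}
  {e : I → I'} {f : J → J'}

/-- Tokens move in the same way along `E` and along an extension `E'` of `E`. -/
theorem tok_iff_of_extends (h : ∀ x, E' (Sum.map g e x) = Sum.map φ (Sum.map g f) (E x))
    {x : L ⊕ I} {u : Q' ⊕ J'} :
    Tok E' (Sum.map g e x) u ↔ ∃ t, Tok E x t ∧ Sum.map φ f t = u := by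
  constructor
  · intro hu
    generalize hy : Sum.map g e x = y at hu
    induction hu generalizing x with
    | pos h' =>
      subst hy
      rw [h] at h'
      cases hE : E x with
      | inl q => rw [hE] at h'; exact ⟨_, .pos hE, by simpa using h'⟩
      | inr t => simp [hE] at h'
    | exit h' =>
      subst hy
      rw [h] at h'
      rcases hE : E x with q | (l | j)
      · simp [hE] at h'
      · simp [hE] at h'
      · rw [hE] at h'; exact ⟨_, .exit hE, by simpa using h'⟩
    | loop h' _ ih =>
      subst hy
      rw [h] at h'
      rcases hE : E x with q | (l | j)
      · simp [hE] at h'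
      · rw [hE] at h'
        obtain ⟨t, ht, rfl⟩ := ih (x := .inl l) (by simpa using h')
        exact ⟨t, .loop hE ht, rfl⟩
      · simp [hE] at h'
  · rintro ⟨t, ht, rfl⟩
    induction ht with
    | pos h' => exact .pos (by rw [h, h']; rfl)
    | exit h' => exact .exit (by rw [h, h']; rfl)
    | loop h' _ ih => exact .loop (by rw [h, h']; rfl) ih

theorem loopProb_of_extends [Fintype L] [Fintype L'] {g : L ≃ L'}
    (h : ∀ x, E' (Sum.map g e x) = Sum.map φ (Sum.map g f) (E x))
    (hφ : Function.Injective φ) (hf : Function.Injective f) {p : Q ⊕ (L ⊕ J) → ℝ≥0}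
    {p' : Q' ⊕ (L' ⊕ J') → ℝ≥0} (hp : ∀ x, p' (Sum.map φ (Sum.map g f) x) = p x) (t : Q ⊕ J) :
    loopProb E' p' (Sum.map φ f t) = loopProb E p t := by
  classical
  rw [loopProb, loopProb, ← g.sum_comp]
  congr 1
  · rw [← hp]
    cases t <;> rfl
  · refine Finset.sum_congr rfl fun l _ => if_congr ?_ (hp (.inr (.inl l))) rfl
    refine (tok_iff_of_extends h (x := .inl l)).trans ⟨?_, fun h => ⟨_, h, rfl⟩⟩
    rintro ⟨t', ht', h'⟩
    rwa [← Sum.map_injective.2 ⟨hφ, hf⟩ h']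

theorem loopProb_eq_zero_of_extends [Fintype L] [Fintype L'] {g : L ≃ L'}
    (h : ∀ x, E' (Sum.map g e x) = Sum.map φ (Sum.map g f) (E x))
    {p' : Q' ⊕ (L' ⊕ J') → ℝ≥0} {t : Q' ⊕ J'} (ht : ∀ t', Sum.map φ f t' ≠ t)
    (hp : p' (Sum.map id .inr t) = 0) :
    loopProb E' p' t = 0 := by
  classical
  rw [loopProb, ← g.sum_comp, hp, zero_add]
  refine Finset.sum_eq_zero fun l _ => if_neg fun hl => ?_
  obtain ⟨t', -, h'⟩ := (tok_iff_of_extends h (x := .inl l)).1 hl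
  exact ht t' h'

end Extension

section Nested

variable {L' : Type} {E₁ : L ⊕ (L' ⊕ I) → Q ⊕ (L ⊕ (L' ⊕ J))} {E₂ : L' ⊕ I → Q ⊕ (L' ⊕ J)}
  {E₃ : (L ⊕ L') ⊕ I → Q ⊕ ((L ⊕ L') ⊕ J)}

/-- A run through the inner loop is the first part of a run through the merged loop. -/
theorem Tok.merge
    (h₃ : ∀ x, E₃ ((Equiv.sumAssoc _ _ _).symm x) =
      Sum.map id (Equiv.sumAssoc _ _ _).symm (E₁ x))
    {x : L ⊕ (L' ⊕ I)} {u : Q ⊕ (L' ⊕ J)} {t : Q ⊕ J} (hx : Tok E₁ x u)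
    (hu : u = Sum.map id .inr t ∨ ∃ l', u = .inr (.inl l') ∧ Tok E₃ (.inl (.inr l')) t) :
    Tok E₃ ((Equiv.sumAssoc _ _ _).symm x) t := by
  induction hx with
  | pos h =>
    rcases hu with hu | ⟨l', hu, -⟩
    · refine .of_eq ?_
      rw [h₃, h]
      cases t <;> simp_all
    · simp at hu
  | @exit x z h =>
    rcases hu with hu | ⟨l', hu, hl'⟩
    · refine .of_eq ?_
      rw [h₃, h]
      cases t <;> simp_all
    · obtain rfl := Sum.inr_injective hu
      exact .loop (l := .inr l') (by rw [h₃, h]; rfl) hl'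
  | @loop x l u h _ ih =>
    have := ih hu
    exact Tok.loop (E := E₃) (l := .inl l) ((h₃ x).trans (by rw [h]; rfl)) this

/-- A run through the outer loop, each step of which is a run `h₂` through the inner loop, is a run
through the merged loop. -/
theorem Tok.merge_outer
    (h₂ : ∀ x, Tok E₁ (.inr x) (E₂ x))
    (h₃ : ∀ x, E₃ ((Equiv.sumAssoc _ _ _).symm x) =
      Sum.map id (Equiv.sumAssoc _ _ _).symm (E₁ x))
    {x : L' ⊕ I} {t : Q ⊕ J} (hx : Tok E₂ x t) :
    Tok E₃ ((Equiv.sumAssoc _ _ _).symm (.inr x)) t := by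
  induction hx with
  | @pos x q h => exact .merge h₃ (h₂ x) (.inl h)
  | @exit x j h => exact .merge h₃ (h₂ x) (.inl h)
  | @loop x l t h _ ih => exact .merge h₃ (h₂ x) (.inr ⟨l, h, ih⟩)

/-- A run through the merged loop splits at the first exit from the inner loop. -/
theorem Tok.split
    (h₂ : ∀ x, Tok E₁ (.inr x) (E₂ x))
    (h₃ : ∀ x, E₃ ((Equiv.sumAssoc _ _ _).symm x) =
      Sum.map id (Equiv.sumAssoc _ _ _).symm (E₁ x))
    {y : (L ⊕ L') ⊕ I} {t : Q ⊕ J} (hy : Tok E₃ y t) (x : L ⊕ (L' ⊕ I))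
    (hyx : y = (Equiv.sumAssoc _ _ _).symm x) :
    ∃ u, Tok E₁ x u ∧
      (u = Sum.map id .inr t ∨ ∃ l', u = .inr (.inl l') ∧ Tok E₂ (.inl l') t) := by
  induction hy generalizing x with
  | @pos y q h =>
    subst hyx
    rw [h₃] at h
    rcases hE : E₁ x with q' | (l | (l' | j)) <;> simp [hE] at h
    subst h
    exact ⟨_, .pos hE, .inl rfl⟩
  | @exit y j h =>
    subst hyx
    rw [h₃] at h
    rcases hE : E₁ x with q' | (l | (l' | j)) <;> simp [hE] at h
    subst h
    exact ⟨_, .exit hE, .inl rfl⟩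
  | @loop y l t h _ ih =>
    subst hyx
    rw [h₃] at h
    rcases hE : E₁ x with q' | (l | (l' | j)) <;> simp [hE] at h <;> subst h
    · obtain ⟨u, hu, hu'⟩ := ih (.inl l) rfl
      exact ⟨u, .loop hE hu, hu'⟩
    · obtain ⟨u, hu, hu'⟩ := ih (.inr (.inl l')) rfl
      refine ⟨_, .exit hE, .inr ⟨l', rfl, ?_⟩⟩
      have hu₂ := hu.unique (h₂ _)
      rcases hu' with rfl | ⟨l₁, rfl, hl₁⟩
      · exact .of_eq hu₂.symm
      · exact .loop hu₂.symm hl₁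

theorem tok_merge_iff
    (h₂ : ∀ x, Tok E₁ (.inr x) (E₂ x))
    (h₃ : ∀ x, E₃ ((Equiv.sumAssoc _ _ _).symm x) =
      Sum.map id (Equiv.sumAssoc _ _ _).symm (E₁ x))
    {l' : L'} {t : Q ⊕ J} : Tok E₃ (.inl (.inr l')) t ↔ Tok E₂ (.inl l') t := by
  refine ⟨fun h => ?_, fun h => h.merge_outer h₂ h₃⟩
  obtain ⟨u, hu, hu'⟩ := h.split h₂ h₃ (.inr (.inl l')) rfl
  have hu₂ := hu.unique (h₂ _)
  rcases hu' with rfl | ⟨l₁, rfl, hl₁⟩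
  · exact .of_eq hu₂.symm
  · exact .loop hu₂.symm hl₁

/-- The transition probabilities after an inner loop and then an outer one are those after the
merged loop: the looping exits of the inner loop are sorted by where the inner loop releases the
token. -/
theorem loopProb_merge [Fintype L] [Fintype L']
    (h₂ : ∀ x, Tok E₁ (.inr x) (E₂ x))
    (h₃ : ∀ x, E₃ ((Equiv.sumAssoc _ _ _).symm x) =
      Sum.map id (Equiv.sumAssoc _ _ _).symm (E₁ x))
    (p : Q ⊕ (L ⊕ (L' ⊕ J)) → ℝ≥0) (t : Q ⊕ J) :
    loopProb E₃ (fun x => p (Sum.map id (Equiv.sumAssoc _ _ _) x)) t =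
      loopProb E₂ (loopProb E₁ p) t := by
  classical
  -- A token on the inner looping exit `l` either leaves the inner loop at `t`, or it comes out at a
  -- unique `l'` in the outer loop, from where it goes on to `t`.
  have hsplit : ∀ l, (if Tok E₃ (.inl (.inl l)) t then p (.inr (.inl l)) else 0) =
      (if Tok E₁ (.inl l) (Sum.map id .inr t) then p (.inr (.inl l)) else 0) +
      ∑ l', if Tok E₂ (.inl l') t then
        (if Tok E₁ (.inl l) (.inr (.inl l')) then p (.inr (.inl l)) else 0) else 0 := by
    intro l
    by_cases hl : Tok E₃ (.inl (.inl l)) t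
    · rw [if_pos hl]
      obtain ⟨u, hu, rfl | ⟨l₁, rfl, hl₁⟩⟩ := hl.split h₂ h₃ (.inl l) rfl
      · rw [if_pos hu, Finset.sum_eq_zero, add_zero]
        intro l' _
        rw [if_neg (c := Tok E₁ _ _), ite_self]
        intro h
        have := hu.unique h
        cases t <;> simp at this
      · rw [if_neg, zero_add, Finset.sum_eq_single l₁, if_pos hl₁, if_pos hu]
        · intro l' _ hl'
          rw [if_neg (c := Tok E₁ _ _), ite_self]
          intro h
          exact hl' (by simpa using h.unique hu)
        · simp
        · intro h
          have := hu.unique h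
          cases t <;> simp at this
    · rw [if_neg hl, if_neg fun h => hl (h.merge h₃ (.inl rfl)), zero_add, Finset.sum_eq_zero]
      intro l' _
      split_ifs with h h'
      · exact (hl (h'.merge h₃ (.inr ⟨l', rfl, h.merge_outer h₂ h₃⟩))).elim
      · rfl
      · rfl
  have hl' : ∀ l', (if Tok E₂ (.inl l') t then loopProb E₁ p (.inr (.inl l')) else 0) =
      (if Tok E₂ (.inl l') t then p (.inr (.inr (.inl l'))) else 0) +
      ∑ l, if Tok E₂ (.inl l') t then
        (if Tok E₁ (.inl l) (.inr (.inl l')) then p (.inr (.inl l)) else 0) else 0 := by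
    intro l'
    split_ifs
    · rfl
    · simp
  rw [loopProb, loopProb, Finset.sum_congr rfl fun l' _ => hl' l', loopProb]
  simp only [Fintype.sum_sum_type, tok_merge_iff h₂ h₃, Sum.map_inr, Equiv.sumAssoc_apply_inl_inl,
    Equiv.sumAssoc_apply_inl_inr, hsplit, Finset.sum_add_distrib]
  rw [Finset.sum_comm (γ := L)]
  have : p (Sum.map id (Equiv.sumAssoc L L' J) (Sum.map id .inr t)) =
      p (Sum.map id .inr (Sum.map id .inr t)) := by cases t <;> rfl
  rw [this]
  ring

end Nested

/-- A token that comes out of `M` at a looping exit `c ∈ C` passes through the wire on `c` and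
leaves at `c`. -/
theorem tok_of_exit_wire {Q Q' B C I J : Type} {E : (C ⊕ B) ⊕ I → Q' ⊕ ((C ⊕ B) ⊕ (C ⊕ J))}
    {φ : Q → Q'} (hC : ∀ c, E (.inl (.inl c)) = .inr (.inr (.inl c))) {x : (C ⊕ B) ⊕ I}
    {y : Q ⊕ (C ⊕ J)} (hx : E x = Sum.map φ (Sum.map .inl .inr) y) :
    Tok E x (Sum.map φ id y) := by
  rcases y with q | (c | j)
  · exact .pos hx
  · exact .loop hx (.exit (hC c))
  · exact .exit hx

end Tokens

section Trace

variable {A : Type u} {I I' J J' K L L' : Type}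
  [Fintype J] [Fintype J'] [Fintype K] [Fintype L] [Fintype L']

theorem leads_iff_tok {M : RoMDP A (L ⊕ I) (L ⊕ J)} {x : L ⊕ I} {t : M.Q ⊕ J} :
    M.Leads x t ↔ Tok M.E x t := by
  constructor <;> intro h
  · induction h with
    | pos h => exact .pos h
    | exit h => exact .exit h
    | loop h _ ih => exact .loop h ih
  · induction h with
    | pos h => exact .pos h
    | exit h => exact .exit h
    | loop h _ ih => exact .loop h ih

theorem traceP_eq_loopProb (M : RoMDP A (L ⊕ I) (L ⊕ J)) (s : M.Q) (a : A) (t : M.Q ⊕ J) :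
    M.traceP s a t = loopProb M.E (M.P s a) t := by
  classical
  simp only [traceP, prec, Finset.sum_filter, loopProb, leads_iff_tok]

theorem tok_trace_E (M : RoMDP A (L ⊕ I) (L ⊕ J)) (i : I) : Tok M.E (.inr i) (M.trace.E i) :=
  leads_iff_tok.1 (M.exists_leads i).choose_spec

/-- To identify a trace it suffices to follow the tokens from the entrances that are not fed
back, and to compute the transition probabilities. -/
theorem trace_equiv {M : RoMDP A (L ⊕ I) (L ⊕ J)} {N : RoMDP A I J} (η : M.Q ≃ N.Q)
    (hE : ∀ i, Tok M.E (.inr i) (Sum.map η.symm id (N.E i)))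
    (hP : ∀ s a t, loopProb M.E (M.P s a) t = N.P (η s) a (Sum.map η id t))
    (hR : ∀ s, M.R s = N.R (η s)) : M.trace ≈ N := by
  refine ⟨⟨η, fun i => ?_, fun s a t => (M.traceP_eq_loopProb s a t).trans (hP s a t), hR⟩⟩
  have h : (M.trace.E i : M.Q ⊕ J) = _ := (M.tok_trace_E i).unique (hE i)
  refine (congrArg (Sum.map η id) h).trans ?_
  cases N.E i <;> simp

/-- Naturality of the trace, and its invariance under renaming of the looping ends. -/
theorem trace_reindex (M : RoMDP A (L ⊕ I) (L ⊕ J)) (g : L ≃ L') (e : I ≃ I') (f : J ≃ J') :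
    (M.reindex (g.sumCongr e) (g.sumCongr f)).trace ≈ M.trace.reindex e f := by
  have h : ∀ x, (M.reindex (g.sumCongr e) (g.sumCongr f)).E (Sum.map g e x) =
      Sum.map id (Sum.map g f) (M.E x) := by
    intro x
    change Sum.map id (Sum.map g f) (M.E (Sum.map g.symm e.symm (Sum.map g e x))) = _
    rw [show Sum.map g.symm e.symm (Sum.map g e x) = x by cases x <;> simp]
  refine trace_equiv (N := M.trace.reindex e f) (Equiv.refl _) (fun i => ?_) (fun s a t => ?_)
    (fun _ => rfl)
  · obtain ⟨i, rfl⟩ := e.surjective i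
    refine (tok_iff_of_extends (Q := M.Q) h (x := .inr i)).2 ⟨_, M.tok_trace_E i, ?_⟩
    change _ = Sum.map id id (Sum.map id f (M.trace.E (e.symm (e i))))
    rw [e.symm_apply_apply]
    exact (Sum.map_id_id ▸ rfl)
  · obtain ⟨t, rfl⟩ : ∃ t', Sum.map id f t' = t :=
      ⟨Sum.map id f.symm t, by cases t <;> simp⟩
    refine (loopProb_of_extends (Q := M.Q) (Q' := M.Q) (p := M.P s a) h Function.injective_id
      f.injective (fun x => ?_) t).trans ?_
    · change M.P s a (Sum.map id (Sum.map g.symm f.symm) _) = _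
      rcases x with q | (l | j) <;> simp
    · refine (M.traceP_eq_loopProb s a t).symm.trans ?_
      change _ = M.traceP s a (Sum.map id f.symm (Sum.map id id (Sum.map id f t)))
      congr 1
      rcases t with q | j
      · rfl
      · exact congrArg Sum.inr (f.symm_apply_apply j).symm

/-- Superposing: the trace commutes with sums. -/
theorem trace_sum (M : RoMDP A (L ⊕ I) (L ⊕ J)) (N : RoMDP A I' J') :
    M.trace.sum N ≈
      ((M.sum N).reindex (Equiv.sumAssoc _ _ _) (Equiv.sumAssoc _ _ _)).trace := by
  have h : ∀ x, ((M.sum N).reindex (Equiv.sumAssoc L I I') (Equiv.sumAssoc L J J')).E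
      (Sum.map (Equiv.refl L) .inl x) = Sum.map .inl (Sum.map (Equiv.refl L) .inl) (M.E x) := by
    rintro (l | i)
    · change Sum.map id (Equiv.sumAssoc _ _ _) (Sum.map Sum.inl Sum.inl (M.E (.inl l))) = _
      rcases M.E (.inl l) with q | (l | j) <;> rfl
    · change Sum.map id (Equiv.sumAssoc _ _ _) (Sum.map Sum.inl Sum.inl (M.E (.inr i))) = _
      rcases M.E (.inr i) with q | (l | j) <;> rfl
  refine Setoid.symm (trace_equiv (N := M.trace.sum N) (Equiv.refl _) ?_ ?_ ?_)
  · rintro (i | i)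
    · refine (tok_iff_of_extends (Q := M.Q) (Q' := M.Q ⊕ N.Q) h (x := .inr i)).2
        ⟨_, M.tok_trace_E i, ?_⟩
      change _ = Sum.map id id (Sum.map Sum.inl Sum.inl (M.trace.E i))
      rw [Sum.map_id_id]
      rfl
    · change Tok _ _ (Sum.map id id (Sum.map Sum.inr Sum.inr (N.E i)))
      refine .of_eq ?_
      change Sum.map id (Equiv.sumAssoc _ _ _) (Sum.map Sum.inr Sum.inr (N.E i)) = _
      cases N.E i <;> rfl
  · rintro (s | s) a t
    · have hin : ∀ t : M.Q ⊕ J, _ := loopProb_of_extends (Q := M.Q) (Q' := M.Q ⊕ N.Q)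
        (p := M.P s a)
        (p' := ((M.sum N).reindex (Equiv.sumAssoc L I I') (Equiv.sumAssoc L J J')).P (.inl s) a)
        h Sum.inl_injective Sum.inl_injective
        (by rintro (q | (l | j)) <;> rfl)
      rcases t with (q | q) | (j | j)
      · exact (hin (.inl q)).trans (M.traceP_eq_loopProb s a _).symm
      · exact loopProb_eq_zero_of_extends (Q := M.Q) (Q' := M.Q ⊕ N.Q) h
          (by rintro (q | j) <;> exact fun h => by cases h) rfl
      · exact (hin (.inr j)).trans (M.traceP_eq_loopProb s a _).symm
      · exact loopProb_eq_zero_of_extends (Q := M.Q) (Q' := M.Q ⊕ N.Q) h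
          (by rintro (q | j) <;> exact fun h => by cases h) rfl
    · refine (loopProb_of_loop_eq_zero (fun l => rfl) t).trans ?_
      rcases t with (q | q) | (j | j) <;> rfl
  · rintro (s | s) <;> rfl

/-- Vanishing: two nested loops can be merged into one. -/
theorem trace_trace (M : RoMDP A (L ⊕ (L' ⊕ I)) (L ⊕ (L' ⊕ J))) :
    M.trace.trace ≈
      (M.reindex (Equiv.sumAssoc _ _ _).symm (Equiv.sumAssoc _ _ _).symm).trace := by
  have h₃ : ∀ x, (M.reindex (Equiv.sumAssoc L L' I).symm (Equiv.sumAssoc L L' J).symm).E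
      ((Equiv.sumAssoc _ _ _).symm x) = Sum.map id (Equiv.sumAssoc _ _ _).symm (M.E x) := by
    intro x
    change Sum.map id _ (M.E (Equiv.sumAssoc _ _ _ ((Equiv.sumAssoc _ _ _).symm x))) = _
    rw [Equiv.apply_symm_apply]
  refine Setoid.symm (trace_equiv (N := M.trace.trace) (Equiv.refl _) (fun i => ?_)
    (fun s a t => ?_) (fun s => rfl))
  · have := (M.trace.tok_trace_E i).merge_outer (Q := M.Q) M.tok_trace_E h₃
    refine cast (congrArg (Tok (Q := M.Q) _ _) ?_) this
    exact (congrFun Sum.map_id_id _).symm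
  · refine (loopProb_merge (Q := M.Q) M.tok_trace_E h₃ (M.P s a) t).trans ?_
    have hP : loopProb M.E (M.P s a) = M.trace.P s a :=
      funext fun x => (M.traceP_eq_loopProb s a x).symm
    have ht : t = Sum.map id id t := (congrFun Sum.map_id_id t).symm
    refine Eq.trans ?_ (congrArg (M.trace.traceP s a) ht)
    refine Eq.trans ?_ (M.trace.traceP_eq_loopProb s a t).symm
    exact congrArg (fun p => loopProb (Q := M.Q) M.trace.E p t) hP

/-- A sequential composition is a trace of a sum. -/
theorem seq_equiv_trace (M : RoMDP A I K) (N : RoMDP A K J) :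
    M.seq N ≈ ((M.sum N).reindex (Equiv.sumComm _ _) (Equiv.refl _)).trace := by
  classical
  have hI : ∀ i, ((M.sum N).reindex (Equiv.sumComm I K) (Equiv.refl (K ⊕ J))).E (.inr i) =
      Sum.map .inl .inl (M.E i) := fun i => congrFun Sum.map_id_id _
  have hK : ∀ k, ((M.sum N).reindex (Equiv.sumComm I K) (Equiv.refl (K ⊕ J))).E (.inl k) =
      Sum.map .inr .inr (N.E k) := fun i => congrFun Sum.map_id_id _
  have hl : ∀ k, Tok (Q := M.Q ⊕ N.Q)
      ((M.sum N).reindex (Equiv.sumComm I K) (Equiv.refl (K ⊕ J))).E (.inl k)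
      (Sum.map .inr id (N.E k)) := fun k => by
    refine .of_eq ((hK k).trans ?_)
    cases N.E k <;> rfl
  refine Setoid.symm (trace_equiv (N := M.seq N) (Equiv.refl _) (fun i => ?_)
    ?_ ?_)
  · change Tok (Q := M.Q ⊕ N.Q) _ _ (Sum.map id id (seqE M N i))
    rw [Sum.map_id_id, id, seqE]
    rcases hE : M.E i with q | k
    · exact .pos ((hI i).trans (by rw [hE]; rfl))
    · exact .loop ((hI i).trans (by rw [hE]; rfl)) (hl k)
  · have hq : ∀ k q, (Sum.map .inr id (N.E k) : (M.Q ⊕ N.Q) ⊕ J) = .inl (.inr q) ↔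
        N.E k = .inl q := fun k q => by cases N.E k <;> simp
    have hq' : ∀ k q, (Sum.map .inr id (N.E k) : (M.Q ⊕ N.Q) ⊕ J) ≠ .inl (.inl q) :=
      fun k q => by cases N.E k <;> simp
    have hj : ∀ k j, (Sum.map .inr id (N.E k) : (M.Q ⊕ N.Q) ⊕ J) = .inr j ↔
        N.E k = .inr j := fun k q => by cases N.E k <;> simp
    have key : ∀ (_ : DecidableEq ((M.Q ⊕ N.Q) ⊕ J)) (s : M.Q ⊕ N.Q) a (t : (M.Q ⊕ N.Q) ⊕ J),
        sumP M N s a (Sum.map id .inr t) + ∑ k, (if Sum.map .inr id (N.E k) = t then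
          sumP M N s a (.inr (.inl k)) else 0) = seqP M N s a t := by
      rintro _ (s | s) a ((q | q) | j) <;> simp [seqP, sumP, hq, hq', hj]
    intro s a t
    refine (loopProb_eq_of_tok (Q := M.Q ⊕ N.Q) (p := fun x => sumP M N s a (Sum.map id id x))
      _ (fun k _ => hl k) t).trans ?_
    simp only [Sum.map_id_id, id]
    exact (key (fun _ _ => Classical.propDecidable _) s a t).trans
      (congrArg (seqP M N s a) (congrFun Sum.map_id_id t).symm)
  · rintro (s | s) <;> rfl

/-- Wires that are plugged into the entrances in `B` and into the exits in `C` of `M` can be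
removed. The wire from the entrance `b` comes out at a looping exit and enters `M` at `b`; the exit
`c` of `M` loops back into the wire that leads to the exit `c`. -/
theorem trace_wire_sum {B C : Type} [Fintype B] [Fintype C] (M : RoMDP A (B ⊕ I) (C ⊕ J))
    (e : (B ⊕ C) ⊕ (B ⊕ I) ≃ (C ⊕ B) ⊕ (B ⊕ I))
    (f : (B ⊕ C) ⊕ (C ⊕ J) ≃ (C ⊕ B) ⊕ (C ⊕ J))
    (heB : ∀ b, e (.inr (.inl b)) = .inl (.inr b))
    (heC : ∀ c, e (.inl (.inr c)) = .inl (.inl c))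
    (heB' : ∀ b, e (.inl (.inl b)) = .inr (.inl b))
    (heI : ∀ i, e (.inr (.inr i)) = .inr (.inr i))
    (hfB : ∀ b, f (.inl (.inl b)) = .inl (.inr b))
    (hfC : ∀ c, f (.inr (.inl c)) = .inl (.inl c))
    (hfC' : ∀ c, f (.inl (.inr c)) = .inr (.inl c))
    (hfJ : ∀ j, f (.inr (.inr j)) = .inr (.inr j)) :
    (((wire A (Equiv.refl (B ⊕ C))).sum M).reindex e f).trace ≈ M := by
  classical
  have hW : ∀ x, (((wire A (Equiv.refl (B ⊕ C))).sum M).reindex e f).E (e (.inl x)) =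
      .inr (f (.inl x)) := by
    intro x
    change Sum.map id f (((wire A (Equiv.refl (B ⊕ C))).sum M).E (e.symm (e (.inl x)))) = _
    rw [e.symm_apply_apply]
    rfl
  have hB : ∀ b, (((wire A (Equiv.refl (B ⊕ C))).sum M).reindex e f).E (.inr (.inl b)) =
      .inr (.inl (.inr b)) := fun b => by rw [← heB', hW, hfB]
  have hC : ∀ c, (((wire A (Equiv.refl (B ⊕ C))).sum M).reindex e f).E (.inl (.inl c)) =
      .inr (.inr (.inl c)) := fun c => by rw [← heC, hW, hfC']
  have hf : (fun j => f (.inr j)) = Sum.map .inl .inr := by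
    funext j
    rcases j with c | j
    · exact hfC c
    · exact hfJ j
  have hM : ∀ y, (((wire A (Equiv.refl (B ⊕ C))).sum M).reindex e f).E (e (.inr y)) =
      Sum.map Sum.inr (Sum.map Sum.inl Sum.inr) (M.E y) := by
    intro y
    rw [← hf]
    change Sum.map id f (((wire A (Equiv.refl (B ⊕ C))).sum M).E (e.symm (e (.inr y)))) = _
    rw [e.symm_apply_apply]
    change Sum.map id f (Sum.map Sum.inr Sum.inr (M.E y)) = _
    cases M.E y <;> rfl
  have hT : ∀ y, Tok (Q := Empty ⊕ M.Q)
      (((wire A (Equiv.refl (B ⊕ C))).sum M).reindex e f).E (e (.inr y))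
      (Sum.map .inr id (M.E y)) := fun y => tok_of_exit_wire hC (hM y)
  refine trace_equiv (Equiv.emptySum Empty M.Q) ?_ ?_ ?_
  · have hsymm : ∀ y : M.Q ⊕ (C ⊕ J),
        (Sum.map .inr id y : (Empty ⊕ M.Q) ⊕ (C ⊕ J)) =
          Sum.map (Equiv.emptySum Empty M.Q).symm id y := by rintro (q | j) <;> rfl
    rintro (b | i)
    · exact .loop (hB b) (hsymm (M.E (.inl b)) ▸ heB b ▸ hT (.inl b))
    · exact hsymm (M.E (.inr i)) ▸ heI i ▸ hT (.inr i)
  · rintro (s | s) a t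
    · exact s.elim
    refine (loopProb_eq_of_tok (Q := Empty ⊕ M.Q)
      (p := fun x => sumP (wire A (Equiv.refl (B ⊕ C))) M (.inr s) a (Sum.map id f.symm x))
      (Sum.elim (fun c => .inr (.inl c)) (fun b => Sum.map .inr id (M.E (.inl b)))) ?_ t).trans ?_
    · rintro (c | b) -
      · exact .exit (hC c)
      · exact heB b ▸ hT (.inl b)
    · have hB' : ∀ b, f.symm (.inl (.inr b)) = .inl (.inl b) := fun b => by
        rw [f.symm_apply_eq, hfB]
      have hC' : ∀ c, f.symm (.inl (.inl c)) = .inr (.inl c) := fun c => by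
        rw [f.symm_apply_eq, hfC]
      have hC'' : ∀ c, f.symm (.inr (.inl c)) = .inl (.inr c) := fun c => by
        rw [f.symm_apply_eq, hfC']
      have hJ' : ∀ j, f.symm (.inr (.inr j)) = .inr (.inr j) := fun j => by
        rw [f.symm_apply_eq, hfJ]
      have key : ∀ (W : RoMDP A (B ⊕ C) (B ⊕ C))
          (_ : DecidableEq ((W.Q ⊕ M.Q) ⊕ (C ⊕ J))) (y : M.Q ⊕ (C ⊕ J)),
          sumP W M (.inr s) a (Sum.map id f.symm (Sum.map id .inr (Sum.map .inr id y))) +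
            ∑ l, (if (Sum.elim (fun c => .inr (.inl c))
                (fun b => Sum.map .inr id (M.E (.inl b))) l :
                (W.Q ⊕ M.Q) ⊕ (C ⊕ J)) = Sum.map .inr id y then
              sumP W M (.inr s) a (Sum.map id f.symm (.inr (.inl l))) else 0) = M.P s a y := by
        rintro W _ (q | (c | j)) <;> simp [sumP, hB', hC', hC'', hJ']
      rcases t with (q | q) | (c | j)
      · exact q.elim
      · exact key _ _ (.inl q)
      · exact key _ _ (.inr (.inl c))
      · exact key _ _ (.inr (.inr j))
  · rintro (s | s)
    · exact s.elim
    · rfl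

/-- A traced wiring without positions is the wiring along which the tokens move. -/
theorem trace_wire (e : L ⊕ I ≃ L ⊕ J) (e' : I ≃ J)
    (h : ∀ i, Tok (Q := Empty) (fun x => .inr (e x)) (.inr i) (.inr (e' i))) :
    (wire A e).trace ≈ wire A e' :=
  trace_equiv (Equiv.refl _) h (fun s => s.elim) (fun s => s.elim)

end Trace

end RoMDP

/-! ### Rightward open MDPs modulo isomorphism -/

namespace RoMDP

variable {A : Type u} {I₁ I₂ I₃ I₄ J₁ J₂ J₃ J₄ : Type}
  [Fintype J₁] [Fintype J₂] [Fintype J₃] [Fintype J₄]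

theorem sum_sum_sum_comm (M₁ : RoMDP A I₁ J₁) (M₂ : RoMDP A I₂ J₂) (M₃ : RoMDP A I₃ J₃)
    (M₄ : RoMDP A I₄ J₄) :
    (M₁.sum M₂).sum (M₃.sum M₄) ≈ ((M₁.sum M₃).sum (M₂.sum M₄)).reindex
      (Equiv.sumSumSumComm _ _ _ _) (Equiv.sumSumSumComm _ _ _ _) := by
  refine ⟨⟨Equiv.sumSumSumComm _ _ _ _, ?_, ?_, ?_⟩⟩
  · rintro ((i | i) | (i | i))
    · change Sum.map (Equiv.sumSumSumComm _ _ _ _) id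
          (Sum.map Sum.inl Sum.inl (Sum.map Sum.inl Sum.inl (M₁.E i))) =
        Sum.map id (Equiv.sumSumSumComm _ _ _ _)
          (Sum.map Sum.inl Sum.inl (Sum.map Sum.inl Sum.inl (M₁.E i)))
      cases M₁.E i <;> rfl
    · change Sum.map (Equiv.sumSumSumComm _ _ _ _) id
          (Sum.map Sum.inl Sum.inl (Sum.map Sum.inr Sum.inr (M₂.E i))) =
        Sum.map id (Equiv.sumSumSumComm _ _ _ _)
          (Sum.map Sum.inr Sum.inr (Sum.map Sum.inl Sum.inl (M₂.E i)))
      cases M₂.E i <;> rfl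
    · change Sum.map (Equiv.sumSumSumComm _ _ _ _) id
          (Sum.map Sum.inr Sum.inr (Sum.map Sum.inl Sum.inl (M₃.E i))) =
        Sum.map id (Equiv.sumSumSumComm _ _ _ _)
          (Sum.map Sum.inl Sum.inl (Sum.map Sum.inr Sum.inr (M₃.E i)))
      cases M₃.E i <;> rfl
    · change Sum.map (Equiv.sumSumSumComm _ _ _ _) id
          (Sum.map Sum.inr Sum.inr (Sum.map Sum.inr Sum.inr (M₄.E i))) =
        Sum.map id (Equiv.sumSumSumComm _ _ _ _)
          (Sum.map Sum.inr Sum.inr (Sum.map Sum.inr Sum.inr (M₄.E i)))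
      cases M₄.E i <;> rfl
  · rintro ((s | s) | (s | s)) a (((q | q) | (q | q)) | ((j | j) | (j | j))) <;> rfl
  · rintro ((s | s) | (s | s)) <;> rfl

end RoMDP

/-- Rightward open MDPs with entrances `I` and exits `J`, modulo isomorphism. The arrows
`RoArrow A m n` are the case `I = Fin m`, `J = Fin n`. -/
abbrev RoClass (A : Type u) (I J : Type) [Fintype J] : Type (max u 1) :=
  Quotient (RoMDP.setoid A I J)

namespace RoClass

section Operations

variable {A : Type u} {I I' I'' J J' J'' K L L' I₁ I₂ J₁ J₂ : Type} [Fintype J] [Fintype J']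
  [Fintype J''] [Fintype L] [Fintype L'] [Fintype J₁] [Fintype J₂]

/-- The wiring without positions given by a bijection from the entrances to the exits. -/
def wire (A : Type u) (e : I ≃ J) : RoClass A I J := ⟦RoMDP.wire A e⟧

/-- Renaming of entrances and exits. -/
def reindex (e : I ≃ I') (f : J ≃ J') (x : RoClass A I J) : RoClass A I' J' :=
  Quotient.map (RoMDP.reindex e f) (fun _ _ h => RoMDP.reindex_congr _ _ h) x

/-- Juxtaposition. -/
def sum (x : RoClass A I J) (y : RoClass A I' J') : RoClass A (I ⊕ I') (J ⊕ J') :=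
  Quotient.map₂ RoMDP.sum (fun _ _ h _ _ h' => RoMDP.sum_congr h h') x y

/-- Sequential composition. -/
noncomputable def seq [Fintype K] (x : RoClass A I K) (y : RoClass A K J) : RoClass A I J :=
  Quotient.map₂ RoMDP.seq (fun _ _ h _ _ h' => RoMDP.seq_congr h h') x y

/-- The trace along the bijections `E` and `F`, which select the entrances and exits to be
connected (those sent to `L`) and name the remaining ones. -/
noncomputable def close (E : I ≃ L ⊕ I') (F : J ≃ L ⊕ J') (x : RoClass A I J) : RoClass A I' J' :=
  Quotient.map (fun M => (M.reindex E F).trace)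
    (fun _ _ h => RoMDP.trace_congr (RoMDP.reindex_congr _ _ h)) x

/-- Exchange of the first two summands. -/
def sumLeftComm (α β γ : Type) : α ⊕ (β ⊕ γ) ≃ β ⊕ (α ⊕ γ) where
  toFun := Sum.elim (fun a => .inr (.inl a)) (Sum.elim .inl fun c => .inr (.inr c))
  invFun := Sum.elim (fun b => .inr (.inl b)) (Sum.elim .inl fun c => .inr (.inr c))
  left_inv := by rintro (a | b | c) <;> rfl
  right_inv := by rintro (a | b | c) <;> rfl

theorem reindex_refl (x : RoClass A I J) : reindex (Equiv.refl I) (Equiv.refl J) x = x := by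
  induction x using Quotient.inductionOn
  exact Quotient.sound (RoMDP.reindex_refl _)

theorem reindex_reindex (e : I ≃ I') (f : J ≃ J') (e' : I' ≃ I'') (f' : J' ≃ J'')
    (x : RoClass A I J) :
    reindex e' f' (reindex e f x) = reindex (e.trans e') (f.trans f') x := by
  induction x using Quotient.inductionOn
  exact Quotient.sound (RoMDP.reindex_reindex _ _ _ _ _)

theorem reindex_wire (e : I ≃ J) (a : I ≃ I') (b : J ≃ J') :
    reindex a b (wire A e) = wire A ((a.symm.trans e).trans b) :=
  Quotient.sound (RoMDP.wire_reindex _ _ _)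

theorem wire_sum_wire (e : I ≃ J) (f : I' ≃ J') :
    sum (wire A e) (wire A f) = wire A (e.sumCongr f) :=
  Quotient.sound (RoMDP.wire_sum_wire _ _)

theorem sum_reindex {K' : Type} (e : I ≃ I') (f : J ≃ J') (e' : K ≃ K') (f' : L ≃ L')
    (x : RoClass A I J) (y : RoClass A K L) :
    sum (reindex e f x) (reindex e' f' y) =
      reindex (e.sumCongr e') (f.sumCongr f') (sum x y) := by
  induction x using Quotient.inductionOn
  induction y using Quotient.inductionOn
  exact Quotient.sound (RoMDP.sum_reindex _ _ _ _ _ _)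

theorem reindex_sum_left (e : I ≃ I') (f : J ≃ J') (x : RoClass A I J) (y : RoClass A K L) :
    sum (reindex e f x) y =
      reindex (e.sumCongr (Equiv.refl _)) (f.sumCongr (Equiv.refl _)) (sum x y) := by
  rw [← sum_reindex, reindex_refl]

theorem reindex_sum_right (e : I ≃ I') (f : J ≃ J') (x : RoClass A I J) (y : RoClass A K L) :
    sum y (reindex e f x) =
      reindex ((Equiv.refl _).sumCongr e) ((Equiv.refl _).sumCongr f) (sum y x) := by
  rw [← sum_reindex, reindex_refl]

theorem sum_comm (x : RoClass A I J) (y : RoClass A I' J') :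
    sum x y = reindex (Equiv.sumComm _ _) (Equiv.sumComm _ _) (sum y x) := by
  induction x using Quotient.inductionOn
  induction y using Quotient.inductionOn
  exact Quotient.sound (RoMDP.sum_comm _ _)

theorem sum_assoc (x : RoClass A I J) (y : RoClass A I' J') (z : RoClass A I'' J'') :
    sum x (sum y z) =
      reindex (Equiv.sumAssoc _ _ _) (Equiv.sumAssoc _ _ _) (sum (sum x y) z) := by
  induction x using Quotient.inductionOn
  induction y using Quotient.inductionOn
  induction z using Quotient.inductionOn
  exact Quotient.sound (RoMDP.sum_assoc _ _ _)

theorem sum_sum_sum_comm (x : RoClass A I J) (y : RoClass A I' J') (z : RoClass A I₁ J₁)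
    (w : RoClass A I₂ J₂) :
    sum (sum x y) (sum z w) = reindex (Equiv.sumSumSumComm _ _ _ _)
      (Equiv.sumSumSumComm _ _ _ _) (sum (sum x z) (sum y w)) := by
  induction x using Quotient.inductionOn
  induction y using Quotient.inductionOn
  induction z using Quotient.inductionOn
  induction w using Quotient.inductionOn
  exact Quotient.sound (RoMDP.sum_sum_sum_comm _ _ _ _)

theorem sum_wire_of_isEmpty [IsEmpty K] [IsEmpty L] (x : RoClass A I J) (e : K ≃ L) :
    sum x (wire A e) = reindex (Equiv.sumEmpty I K).symm (Equiv.sumEmpty J L).symm x := by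
  induction x using Quotient.inductionOn
  exact Quotient.sound (RoMDP.sum_wire_of_isEmpty _ _)

theorem seq_wire [Fintype K] (x : RoClass A I K) (e : K ≃ J) :
    seq x (wire A e) = reindex (Equiv.refl I) e x := by
  induction x using Quotient.inductionOn
  exact Quotient.sound (RoMDP.seq_wire _ _)

theorem wire_seq [Fintype K] (x : RoClass A K J) (e : I ≃ K) :
    seq (wire A e) x = reindex e.symm (Equiv.refl J) x := by
  induction x using Quotient.inductionOn
  exact Quotient.sound (RoMDP.wire_seq _ _)

/-- Traces that differ by a renaming of the connected ends and by a renaming `e`, `f` of the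
remaining ends. -/
theorem close_eq_reindex_close {E : I ≃ L ⊕ I'} {F : J ≃ L ⊕ J'} {E' : I ≃ L' ⊕ I''}
    {F' : J ≃ L' ⊕ J''} (g : L ≃ L') (e : I' ≃ I'') (f : J' ≃ J'')
    (hE : ∀ i, E' i = Sum.map g e (E i)) (hF : ∀ j, F' j = Sum.map g f (F j))
    (x : RoClass A I J) : close E' F' x = reindex e f (close E F x) := by
  obtain rfl : E' = E.trans (g.sumCongr e) := Equiv.ext hE
  obtain rfl : F' = F.trans (g.sumCongr f) := Equiv.ext hF
  induction x using Quotient.inductionOn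
  exact Quotient.sound (Setoid.trans
    (RoMDP.trace_congr (Setoid.symm (RoMDP.reindex_reindex _ _ _ _ _)))
    (RoMDP.trace_reindex _ _ _ _))

theorem close_congr {E : I ≃ L ⊕ I'} {F : J ≃ L ⊕ J'} {E' : I ≃ L' ⊕ I'}
    {F' : J ≃ L' ⊕ J'} (g : L ≃ L') (hE : ∀ i, E' i = Sum.map g id (E i))
    (hF : ∀ j, F' j = Sum.map g id (F j)) (x : RoClass A I J) : close E' F' x = close E F x := by
  rw [close_eq_reindex_close g (Equiv.refl _) (Equiv.refl _) hE hF, reindex_refl]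

theorem reindex_close (E : I ≃ L ⊕ I') (F : J ≃ L ⊕ J') (e : I' ≃ I'') (f : J' ≃ J'')
    (x : RoClass A I J) : reindex e f (close E F x) =
      close (E.trans ((Equiv.refl _).sumCongr e)) (F.trans ((Equiv.refl _).sumCongr f)) x :=
  (close_eq_reindex_close (Equiv.refl _) e f (fun _ => rfl) (fun _ => rfl) x).symm

theorem close_reindex (e : I ≃ I') (f : J ≃ J') (E : I' ≃ L ⊕ I'') (F : J' ≃ L ⊕ J'')
    (x : RoClass A I J) : close E F (reindex e f x) = close (e.trans E) (f.trans F) x := by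
  induction x using Quotient.inductionOn
  exact Quotient.sound (RoMDP.trace_congr (RoMDP.reindex_reindex _ _ _ _ _))

/-- The trace commutes with sums on the right. -/
theorem close_sum (E : I ≃ L ⊕ I') (F : J ≃ L ⊕ J') (x : RoClass A I J) (y : RoClass A I₁ J₁) :
    sum (close E F x) y =
      close ((E.sumCongr (Equiv.refl _)).trans (Equiv.sumAssoc _ _ _))
        ((F.sumCongr (Equiv.refl _)).trans (Equiv.sumAssoc _ _ _)) (sum x y) := by
  rw [← close_reindex, ← reindex_sum_left]
  induction x using Quotient.inductionOn
  induction y using Quotient.inductionOn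
  exact Quotient.sound (RoMDP.trace_sum _ _)

/-- The trace commutes with sums on the left. -/
theorem sum_close (E : I ≃ L ⊕ I') (F : J ≃ L ⊕ J') (x : RoClass A I J) (y : RoClass A I₁ J₁) :
    sum y (close E F x) =
      close (((Equiv.refl _).sumCongr E).trans (sumLeftComm _ _ _))
        (((Equiv.refl _).sumCongr F).trans (sumLeftComm _ _ _)) (sum y x) := by
  rw [sum_comm, close_sum, reindex_close, sum_comm x y, close_reindex]
  have key : ∀ {I' : Type} (z : L ⊕ I'), Sum.map id Sum.swap (Equiv.sumAssoc L I' I₁ (.inl z)) =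
      Sum.map id id (sumLeftComm I₁ L I' (.inr z)) := by
    rintro I' (l | i) <;> rfl
  have key' : ∀ {J' : Type} (z : L ⊕ J'), Sum.map id Sum.swap (Equiv.sumAssoc L J' J₁ (.inl z)) =
      Sum.map id id (sumLeftComm J₁ L J' (.inr z)) := by
    rintro J' (l | j) <;> rfl
  refine close_congr (Equiv.refl _) ?_ ?_ _
  · rintro (i | i)
    · rfl
    · exact key (E i)
  · rintro (j | j)
    · rfl
    · exact key' (F j)

/-- Two successive traces are a trace of the two sets of loops at once. -/
theorem close_close (E : I ≃ L ⊕ I') (F : J ≃ L ⊕ J') (E' : I' ≃ L' ⊕ I'') (F' : J' ≃ L' ⊕ J'')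
    (x : RoClass A I J) : close E' F' (close E F x) =
      close ((E.trans ((Equiv.refl _).sumCongr E')).trans (Equiv.sumAssoc _ _ _).symm)
        ((F.trans ((Equiv.refl _).sumCongr F')).trans (Equiv.sumAssoc _ _ _).symm) x := by
  rw [← close_reindex]
  obtain ⟨M, rfl⟩ := Quotient.exists_rep x
  refine Quotient.sound (Setoid.trans (b := ((M.reindex E F).reindex ((Equiv.refl _).sumCongr E')
      ((Equiv.refl _).sumCongr F')).trace.trace) ?_
    (Setoid.trans (RoMDP.trace_trace ((M.reindex E F).reindex ((Equiv.refl _).sumCongr E')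
      ((Equiv.refl _).sumCongr F'))) ?_))
  · exact RoMDP.trace_congr (Setoid.symm (RoMDP.trace_reindex _ _ _ _))
  · exact RoMDP.trace_congr (RoMDP.reindex_congr _ _ (RoMDP.reindex_reindex _ _ _ _ _))

/-- Sequential composition is the closing of the middle ends of a sum. -/
theorem seq_eq_close [Fintype K] (x : RoClass A I K) (y : RoClass A K J) :
    seq x y = close (Equiv.sumComm _ _) (Equiv.refl _) (sum x y) := by
  induction x using Quotient.inductionOn
  induction y using Quotient.inductionOn
  exact Quotient.sound (RoMDP.seq_equiv_trace _ _)

/-- The entrances of `wire ⊕ x`, when the wires in `B` are plugged into entrances of `x` and the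
wires in `C` into exits of `x`. -/
def plugIn (B C I : Type) : (B ⊕ C) ⊕ (B ⊕ I) ≃ (C ⊕ B) ⊕ (B ⊕ I) where
  toFun := Sum.elim (Sum.elim (fun b => .inr (.inl b)) (fun c => .inl (.inl c)))
    (Sum.elim (fun b => .inl (.inr b)) (fun i => .inr (.inr i)))
  invFun := Sum.elim (Sum.elim (fun c => .inl (.inr c)) (fun b => .inr (.inl b)))
    (Sum.elim (fun b => .inl (.inl b)) (fun i => .inr (.inr i)))
  left_inv := by rintro ((x | x) | (x | x)) <;> rfl
  right_inv := by rintro ((x | x) | (x | x)) <;> rfl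

/-- The exits of `wire ⊕ x`, when the wires in `B` are plugged into entrances of `x` and the
wires in `C` into exits of `x`. -/
def plugOut (B C J : Type) : (B ⊕ C) ⊕ (C ⊕ J) ≃ (C ⊕ B) ⊕ (C ⊕ J) where
  toFun := Sum.elim (Sum.elim (fun b => .inl (.inr b)) (fun c => .inr (.inl c)))
    (Sum.elim (fun c => .inl (.inl c)) (fun j => .inr (.inr j)))
  invFun := Sum.elim (Sum.elim (fun c => .inr (.inl c)) (fun b => .inl (.inl b)))
    (Sum.elim (fun c => .inl (.inr c)) (fun j => .inr (.inr j)))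
  left_inv := by rintro ((x | x) | (x | x)) <;> rfl
  right_inv := by rintro ((x | x) | (x | x)) <;> rfl

/-- Identity wires that are plugged into `x` can be removed. -/
theorem close_wire_sum {B C : Type} [Fintype B] [Fintype C] (x : RoClass A (B ⊕ I) (C ⊕ J)) :
    close (plugIn B C I) (plugOut B C J) (sum (wire A (Equiv.refl (B ⊕ C))) x) = x := by
  induction x using Quotient.inductionOn
  exact Quotient.sound (RoMDP.trace_wire_sum _ _ _ (fun _ => rfl) (fun _ => rfl)
    (fun _ => rfl) (fun _ => rfl) (fun _ => rfl) (fun _ => rfl) (fun _ => rfl)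
    (fun _ => rfl))

/-- A closed wiring is the wiring along which the tokens move. -/
theorem close_wire (e : I ≃ J) (E : I ≃ L ⊕ I') (F : J ≃ L ⊕ J') (e' : I' ≃ J')
    (h : ∀ i, RoMDP.Tok (Q := Empty) (fun x => .inr (F (e (E.symm x)))) (.inr i) (.inr (e' i))) :
    close E F (wire A e) = wire A e' :=
  Quotient.sound (Setoid.trans (RoMDP.trace_congr (RoMDP.wire_reindex _ _ _))
    (RoMDP.trace_wire _ _ h))

end Operations

end RoClass

/-! ### Bidirectional composition and sum -/

namespace RoClass

section Bidirectional

variable {A : Type u} {R L R' L' R'' L'' R''' L''' R₁ L₁ R₁' L₁' R₁'' L₁'' R₂ L₂ R₂' L₂' : Type}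
  [Fintype R] [Fintype L] [Fintype R'] [Fintype L'] [Fintype R''] [Fintype L'']
  [Fintype R'''] [Fintype L'''] [Fintype R₁] [Fintype L₁] [Fintype R₁'] [Fintype L₁']
  [Fintype R₁''] [Fintype L₁''] [Fintype R₂] [Fintype L₂] [Fintype R₂'] [Fintype L₂']

/-- The entrances of two composable bidirectional arrows: the ends of the middle object are
connected. -/
def compIn (R L' R' L'' : Type) : (R ⊕ L') ⊕ (R' ⊕ L'') ≃ (L' ⊕ R') ⊕ (R ⊕ L'') where
  toFun := Sum.elim (Sum.elim (fun x => .inr (.inl x)) (fun x => .inl (.inl x)))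
    (Sum.elim (fun x => .inl (.inr x)) (fun x => .inr (.inr x)))
  invFun := Sum.elim (Sum.elim (fun x => .inl (.inr x)) (fun x => .inr (.inl x)))
    (Sum.elim (fun x => .inl (.inl x)) (fun x => .inr (.inr x)))
  left_inv := by rintro ((x | x) | (x | x)) <;> rfl
  right_inv := by rintro ((x | x) | (x | x)) <;> rfl

/-- The exits of two composable bidirectional arrows: the ends of the middle object are
connected. -/
def compOut (R' L R'' L' : Type) : (R' ⊕ L) ⊕ (R'' ⊕ L') ≃ (L' ⊕ R') ⊕ (R'' ⊕ L) where
  toFun := Sum.elim (Sum.elim (fun x => .inl (.inr x)) (fun x => .inr (.inr x)))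
    (Sum.elim (fun x => .inr (.inl x)) (fun x => .inl (.inl x)))
  invFun := Sum.elim (Sum.elim (fun x => .inr (.inr x)) (fun x => .inl (.inl x)))
    (Sum.elim (fun x => .inr (.inl x)) (fun x => .inl (.inr x)))
  left_inv := by rintro ((x | x) | (x | x)) <;> rfl
  right_inv := by rintro ((x | x) | (x | x)) <;> rfl

/-- The order of the ends in a bidirectional sum. -/
def tensorEnds (R L R' L' : Type) : (R ⊕ L) ⊕ (R' ⊕ L') ≃ (R ⊕ R') ⊕ (L' ⊕ L) where
  toFun := Sum.elim (Sum.elim (fun x => .inl (.inl x)) (fun x => .inr (.inr x)))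
    (Sum.elim (fun x => .inl (.inr x)) (fun x => .inr (.inl x)))
  invFun := Sum.elim (Sum.elim (fun x => .inl (.inl x)) (fun x => .inr (.inl x)))
    (Sum.elim (fun x => .inr (.inr x)) (fun x => .inl (.inr x)))
  left_inv := by rintro ((x | x) | (x | x)) <;> rfl
  right_inv := by rintro ((x | x) | (x | x)) <;> rfl

/-- Bidirectional composition of arrows `(R, L) ⟶ (R', L') ⟶ (R'', L'')`: the two open MDPs are put
side by side, and the ends in `R'` and `L'` are connected. -/
noncomputable def comp (x : RoClass A (R ⊕ L') (R' ⊕ L)) (y : RoClass A (R' ⊕ L'') (R'' ⊕ L')) :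
    RoClass A (R ⊕ L'') (R'' ⊕ L) :=
  close (compIn R L' R' L'') (compOut R' L R'' L') (sum x y)

/-- Bidirectional sum. -/
def tensor (x : RoClass A (R ⊕ L') (R' ⊕ L)) (y : RoClass A (R₁ ⊕ L₁') (R₁' ⊕ L₁)) :
    RoClass A ((R ⊕ R₁) ⊕ (L₁' ⊕ L')) ((R' ⊕ R₁') ⊕ (L₁ ⊕ L)) :=
  reindex (tensorEnds _ _ _ _) (tensorEnds _ _ _ _) (sum x y)

/-- The bidirectional arrow `(R, L) ⟶ (R', L')` without positions given by bijections between the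
rightward and between the leftward ends. -/
def biwire (A : Type u) (a : R ≃ R') (b : L' ≃ L) : RoClass A (R ⊕ L') (R' ⊕ L) :=
  wire A (a.sumCongr b)

theorem reindex_congr {I I' J J' : Type} [Fintype J] [Fintype J'] {e e' : I ≃ I'} {f f' : J ≃ J'}
    (he : ∀ i, e i = e' i) (hf : ∀ j, f j = f' j) (x : RoClass A I J) :
    reindex e f x = reindex e' f' x := by
  rw [Equiv.ext he, Equiv.ext hf]

/-- Composition with wires renames ends: up to a renaming, the wires are plugged into `y`, and are
removed by `close_wire_sum`. -/
theorem biwire_comp (a : R ≃ R') (b : L' ≃ L) (y : RoClass A (R' ⊕ L'') (R'' ⊕ L')) :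
    comp (biwire A a b) y =
      reindex (a.symm.sumCongr (Equiv.refl L'')) ((Equiv.refl R'').sumCongr b) y := by
  obtain ⟨z, rfl⟩ : ∃ z, y = reindex (Equiv.refl _) (Equiv.sumComm L' R'') z :=
    ⟨reindex (Equiv.refl _) (Equiv.sumComm R'' L') y, by
      rw [reindex_reindex, ← reindex_refl y, reindex_reindex]
      exact reindex_congr (fun _ => rfl) (by rintro (x | x) <;> rfl) y⟩
  have hw : biwire A a b = reindex (a.symm.sumCongr (Equiv.refl L'))
      ((Equiv.refl R').sumCongr b) (wire A (Equiv.refl (R' ⊕ L'))) := by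
    rw [reindex_wire, biwire]
    congr 1
    ext (x | x) <;> rfl
  rw [comp, hw, sum_reindex, close_reindex, close_eq_reindex_close (E := plugIn R' L' L'')
    (F := plugOut R' L' R'') (Equiv.refl _) (a.symm.sumCongr (Equiv.refl L''))
    ((Equiv.sumComm L' R'').trans ((Equiv.refl R'').sumCongr b)), close_wire_sum,
    reindex_reindex]
  · rfl
  · rintro ((x | x) | (x | x)) <;> rfl
  · rintro ((x | x) | (x | x)) <;> rfl

theorem comp_biwire (x : RoClass A (R ⊕ L') (R' ⊕ L)) (a : R' ≃ R'') (b : L'' ≃ L') :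
    comp x (biwire A a b) =
      reindex ((Equiv.refl R).sumCongr b.symm) (a.sumCongr (Equiv.refl L)) x := by
  obtain ⟨z, rfl⟩ : ∃ z, x = reindex (Equiv.sumComm L' R) (Equiv.refl _) z :=
    ⟨reindex (Equiv.sumComm R L') (Equiv.refl _) x, by
      rw [reindex_reindex, ← reindex_refl x, reindex_reindex]
      exact reindex_congr (by rintro (x | x) <;> rfl) (fun _ => rfl) x⟩
  have hw : biwire A a b = reindex ((Equiv.sumComm L' R').trans
      ((Equiv.refl R').sumCongr b.symm)) ((Equiv.sumComm L' R').trans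
      (a.sumCongr (Equiv.refl L'))) (wire A (Equiv.refl (L' ⊕ R'))) := by
    rw [reindex_wire, biwire]
    congr 1
    ext (x | x) <;> rfl
  rw [comp, hw, sum_reindex, close_reindex, sum_comm, close_reindex,
    close_eq_reindex_close (E := plugIn L' R' R) (F := plugOut L' R' L) (Equiv.sumComm _ _)
    ((Equiv.sumComm L' R).trans ((Equiv.refl R).sumCongr b.symm))
    (a.sumCongr (Equiv.refl L)), close_wire_sum, reindex_reindex]
  · rfl
  · rintro ((x | x) | (x | x)) <;> rfl
  · rintro ((x | x) | (x | x)) <;> rfl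

theorem id_comp (y : RoClass A (R ⊕ L') (R' ⊕ L)) :
    comp (biwire A (Equiv.refl R) (Equiv.refl L)) y = y := by
  rw [biwire_comp]
  conv_rhs => rw [← reindex_refl y]
  exact reindex_congr (by rintro (x | x) <;> rfl) (by rintro (x | x) <;> rfl) _

theorem comp_id (y : RoClass A (R ⊕ L') (R' ⊕ L)) :
    comp y (biwire A (Equiv.refl R') (Equiv.refl L')) = y := by
  rw [comp_biwire]
  conv_rhs => rw [← reindex_refl y]
  exact reindex_congr (by rintro (x | x) <;> rfl) (by rintro (x | x) <;> rfl) _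

/-- Both sides close the ends of the two middle objects of `x`, `y` and `z` side by side. -/
theorem comp_assoc (x : RoClass A (R ⊕ L') (R' ⊕ L)) (y : RoClass A (R' ⊕ L'') (R'' ⊕ L'))
    (z : RoClass A (R'' ⊕ L''') (R''' ⊕ L'')) : comp (comp x y) z = comp x (comp y z) := by
  simp only [comp, close_sum, sum_close, close_close, sum_assoc x y z, close_reindex]
  refine close_congr (Equiv.sumComm _ _) ?_ ?_ _ <;>
    rintro (((x | x) | (x | x)) | (x | x)) <;> rfl

/-- Interchange law: both sides close the same ends of the four arrows side by side. -/
theorem tensor_comp_tensor (x : RoClass A (R ⊕ L') (R' ⊕ L)) (y : RoClass A (R' ⊕ L'') (R'' ⊕ L'))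
    (z : RoClass A (R₁ ⊕ L₁') (R₁' ⊕ L₁)) (w : RoClass A (R₁' ⊕ L₁'') (R₁'' ⊕ L₁')) :
    comp (tensor x z) (tensor y w) = tensor (comp x y) (comp z w) := by
  simp only [comp, tensor, close_sum, sum_close, close_close, reindex_close, sum_reindex,
    sum_sum_sum_comm x z y w, close_reindex]
  refine close_congr ((Equiv.sumSumSumComm _ _ _ _).trans
    ((Equiv.sumComm _ _).sumCongr (Equiv.refl _))) ?_ ?_ _ <;>
    rintro (((x | x) | (x | x)) | ((x | x) | (x | x))) <;> rfl

theorem biwire_comp_biwire (a : R ≃ R') (b : L' ≃ L) (a' : R' ≃ R'') (b' : L'' ≃ L') :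
    comp (biwire A a b) (biwire A a' b') = biwire A (a.trans a') (b'.trans b) := by
  rw [biwire_comp, biwire, biwire, reindex_wire]
  congr 1
  ext (x | x) <;> rfl

theorem biwire_tensor_biwire (a : R ≃ R') (b : L' ≃ L) (a' : R₁ ≃ R₁') (b' : L₁' ≃ L₁) :
    tensor (biwire A a b) (biwire A a' b') =
      biwire A (a.sumCongr a') (b'.sumCongr b) := by
  rw [tensor, biwire, biwire, biwire, wire_sum_wire, reindex_wire]
  congr 1
  ext ((x | x) | (x | x)) <;> rfl

/-- The associator is natural. -/
theorem tensor_tensor_comp_assoc (x : RoClass A (R ⊕ L') (R' ⊕ L))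
    (y : RoClass A (R₁ ⊕ L₁') (R₁' ⊕ L₁)) (z : RoClass A (R₂ ⊕ L₂') (R₂' ⊕ L₂)) :
    comp (tensor (tensor x y) z)
        (biwire A (Equiv.sumAssoc R' R₁' R₂') (Equiv.sumAssoc L₂' L₁' L')) =
      comp (biwire A (Equiv.sumAssoc R R₁ R₂) (Equiv.sumAssoc L₂ L₁ L))
        (tensor x (tensor y z)) := by
  simp only [biwire_comp, comp_biwire, tensor, reindex_sum_left, reindex_sum_right,
    reindex_reindex, sum_assoc x y z]
  refine reindex_congr ?_ ?_ _ <;> rintro (((x | x) | (x | x)) | (x | x)) <;> rfl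

/-- The left unitor is natural. -/
theorem tensor_comp_leftUnitor [IsEmpty R₁] [IsEmpty L₁] (x : RoClass A (R ⊕ L') (R' ⊕ L)) :
    comp (tensor (biwire A (Equiv.refl R₁) (Equiv.refl L₁)) x)
        (biwire A (Equiv.emptySum R₁ R') (Equiv.sumEmpty L' L₁).symm) =
      comp (biwire A (Equiv.emptySum R₁ R) (Equiv.sumEmpty L L₁).symm) x := by
  rw [biwire_comp, comp_biwire, tensor, sum_comm, biwire, sum_wire_of_isEmpty]
  simp only [reindex_reindex]
  refine reindex_congr ?_ ?_ _ <;> rintro (x | x) <;> rfl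

/-- The right unitor is natural. -/
theorem tensor_comp_rightUnitor [IsEmpty R₁] [IsEmpty L₁] (x : RoClass A (R ⊕ L') (R' ⊕ L)) :
    comp (tensor x (biwire A (Equiv.refl R₁) (Equiv.refl L₁)))
        (biwire A (Equiv.sumEmpty R' R₁) (Equiv.emptySum L₁ L').symm) =
      comp (biwire A (Equiv.sumEmpty R R₁) (Equiv.emptySum L₁ L).symm) x := by
  rw [biwire_comp, comp_biwire, tensor, biwire, sum_wire_of_isEmpty]
  simp only [reindex_reindex]
  refine reindex_congr ?_ ?_ _ <;> rintro (x | x) <;> rfl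

/-- The braiding is natural. -/
theorem tensor_comp_braiding (x : RoClass A (R ⊕ L') (R' ⊕ L))
    (y : RoClass A (R₁ ⊕ L₁') (R₁' ⊕ L₁)) :
    comp (tensor x y) (biwire A (Equiv.sumComm R' R₁') (Equiv.sumComm L' L₁')) =
      comp (biwire A (Equiv.sumComm R R₁) (Equiv.sumComm L L₁)) (tensor y x) := by
  simp only [biwire_comp, comp_biwire, tensor, sum_comm x y, reindex_reindex]
  refine reindex_congr ?_ ?_ _ <;> rintro ((x | x) | (x | x)) <;> rfl

end Bidirectional

end RoClass

/-! ### Unit, counit and the zigzag identities -/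

namespace RoClass

section Coherence

variable {A : Type u} {R L R' L' : Type} [Fintype R] [Fintype L] [Fintype R'] [Fintype L']

theorem biwire_congr {a a' : R ≃ R'} {b b' : L' ≃ L} (ha : ∀ x, a x = a' x)
    (hb : ∀ x, b x = b' x) : biwire A a b = biwire A a' b' := by
  rw [Equiv.ext ha, Equiv.ext hb]

/-- The unit `0 ⟶ X ⊕ X*` for `X = (R, L)`: the identity wires on `R` and `L`. -/
def unit (A : Type u) (R L : Type) [Fintype R] [Fintype L] :
    RoClass A (Empty ⊕ (R ⊕ L)) ((R ⊕ L) ⊕ Empty) :=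
  wire A ((Equiv.emptySum _ _).trans (Equiv.sumEmpty _ _).symm)

/-- The counit `X* ⊕ X ⟶ 0` for `X = (R, L)`: the identity wires on `L` and `R`. -/
def counit (A : Type u) (R L : Type) [Fintype R] [Fintype L] :
    RoClass A ((L ⊕ R) ⊕ Empty) (Empty ⊕ (L ⊕ R)) :=
  wire A ((Equiv.sumEmpty _ _).trans (Equiv.emptySum _ _).symm)

/-- The zigzag identity that straightens the wires of `(L, R)`. All arrows are wirings without
positions, so it suffices to follow a token from each entrance. -/
theorem zigzag_dual :
    comp (tensor (biwire A (Equiv.refl L) (Equiv.refl R)) (unit A R L))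
        (comp (biwire A (Equiv.sumAssoc L R L).symm (Equiv.sumAssoc R L R).symm)
          (tensor (counit A R L) (biwire A (Equiv.refl L) (Equiv.refl R)))) =
      comp (biwire A (Equiv.sumEmpty L Empty) (Equiv.emptySum Empty R).symm)
        (biwire A (Equiv.emptySum Empty L).symm (Equiv.sumEmpty R Empty)) := by
  rw [biwire_comp_biwire, biwire_comp]
  simp only [comp, tensor, biwire, unit, counit, wire_sum_wire, reindex_wire]
  refine close_wire _ _ _ _ ?_
  rintro ((x | x) | (x | x))
  · repeat first | exact .exit rfl | refine .loop rfl ?_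
  · exact x.elim
  · repeat first | exact .exit rfl | refine .loop rfl ?_
  · exact x.elim

/-- The zigzag identity that straightens the wires of `(R, L)`. -/
theorem zigzag :
    comp (tensor (unit A R L) (biwire A (Equiv.refl R) (Equiv.refl L)))
        (comp (biwire A (Equiv.sumAssoc R L R) (Equiv.sumAssoc L R L))
          (tensor (biwire A (Equiv.refl R) (Equiv.refl L)) (counit A R L))) =
      comp (biwire A (Equiv.emptySum Empty R) (Equiv.sumEmpty L Empty).symm)
        (biwire A (Equiv.sumEmpty R Empty).symm (Equiv.emptySum Empty L)) := by
  rw [biwire_comp_biwire, biwire_comp]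
  simp only [comp, tensor, biwire, unit, counit, wire_sum_wire, reindex_wire]
  refine close_wire _ _ _ _ ?_
  rintro ((x | x) | (x | x))
  · exact x.elim
  · repeat first | exact .exit rfl | refine .loop rfl ?_
  · exact x.elim
  · repeat first | exact .exit rfl | refine .loop rfl ?_

end Coherence

end RoClass

/-! ### The compact closed category over finite types of ends -/

/-- A pair of finite types of rightward and of leftward open ends. The objects of `OMDP A` are the
case of the types `Fin r` and `Fin l`; with arbitrary types the associators and unitors are
explicit bijections, and no arithmetic of `Fin` intervenes. -/
structure OpenEnds (A : Type u) where
  /-- rightward open ends -/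
  r : Type
  /-- leftward open ends -/
  l : Type
  /-- there are finitely many rightward open ends -/
  [fintypeR : Fintype r]
  /-- there are finitely many leftward open ends -/
  [fintypeL : Fintype l]

namespace OpenEnds

attribute [instance] OpenEnds.fintypeR OpenEnds.fintypeL

variable {A : Type u}

/-- Arrows `X ⟶ Y` are open MDPs modulo isomorphism, with entrances the rightward ends of `X` and
the leftward ends of `Y`. -/
noncomputable instance category : Category.{max u 1} (OpenEnds A) where
  Hom X Y := RoClass A (X.r ⊕ Y.l) (Y.r ⊕ X.l)
  id X := RoClass.biwire A (Equiv.refl X.r) (Equiv.refl X.l)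
  comp f g := RoClass.comp f g
  id_comp f := RoClass.id_comp f
  comp_id f := RoClass.comp_id f
  assoc f g h := RoClass.comp_assoc f g h

/-- The isomorphism of objects given by bijections between their ends. -/
noncomputable def isoOfEquiv {X Y : OpenEnds A} (a : X.r ≃ Y.r) (b : Y.l ≃ X.l) : X ≅ Y where
  hom := RoClass.biwire A a b
  inv := RoClass.biwire A a.symm b.symm
  hom_inv_id := (RoClass.biwire_comp_biwire _ _ _ _).trans
    (RoClass.biwire_congr (by simp) (by simp))
  inv_hom_id := (RoClass.biwire_comp_biwire _ _ _ _).trans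
    (RoClass.biwire_congr (by simp) (by simp))

/-- The tensor product juxtaposes, and reverses the order of the leftward ends; the associators and
unitors are given by the canonical bijections of sum types. -/
noncomputable instance monoidalStruct : MonoidalCategoryStruct (OpenEnds A) where
  tensorObj X Y := ⟨X.r ⊕ Y.r, Y.l ⊕ X.l⟩
  tensorHom f g := RoClass.tensor f g
  whiskerLeft X _ _ f := RoClass.tensor (RoClass.biwire A (Equiv.refl X.r) (Equiv.refl X.l)) f
  whiskerRight f X := RoClass.tensor f (RoClass.biwire A (Equiv.refl X.r) (Equiv.refl X.l))
  tensorUnit := ⟨Empty, Empty⟩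
  associator X Y Z := isoOfEquiv (Equiv.sumAssoc X.r Y.r Z.r) (Equiv.sumAssoc Z.l Y.l X.l)
  leftUnitor X := isoOfEquiv (Equiv.emptySum Empty X.r) (Equiv.sumEmpty X.l Empty).symm
  rightUnitor X := isoOfEquiv (Equiv.sumEmpty X.r Empty) (Equiv.emptySum Empty X.l).symm

theorem tensor_id_id (X Y : OpenEnds A) :
    RoClass.tensor (RoClass.biwire A (Equiv.refl X.r) (Equiv.refl X.l))
        (RoClass.biwire A (Equiv.refl Y.r) (Equiv.refl Y.l)) =
      RoClass.biwire A (Equiv.refl (X.r ⊕ Y.r)) (Equiv.refl (Y.l ⊕ X.l)) :=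
  (RoClass.biwire_tensor_biwire _ _ _ _).trans
    (RoClass.biwire_congr (by simp) (by simp))

noncomputable instance monoidal : MonoidalCategory (OpenEnds A) where
  tensorHom_def f g := by
    refine Eq.symm ((RoClass.tensor_comp_tensor _ _ _ _).trans ?_)
    rw [RoClass.comp_id, RoClass.id_comp]
    rfl
  id_tensorHom_id X Y := tensor_id_id X Y
  tensorHom_comp_tensorHom f₁ f₂ g₁ g₂ := RoClass.tensor_comp_tensor _ _ _ _
  whiskerLeft_id X Y := tensor_id_id X Y
  id_whiskerRight X Y := tensor_id_id X Y
  associator_naturality f₁ f₂ f₃ := RoClass.tensor_tensor_comp_assoc f₁ f₂ f₃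
  leftUnitor_naturality f := RoClass.tensor_comp_leftUnitor (R₁ := Empty) (L₁ := Empty) f
  rightUnitor_naturality f := RoClass.tensor_comp_rightUnitor (R₁ := Empty) (L₁ := Empty) f
  pentagon W X Y Z := by
    change RoClass.comp (RoClass.tensor (RoClass.biwire A (Equiv.sumAssoc W.r X.r Y.r)
        (Equiv.sumAssoc Y.l X.l W.l)) (RoClass.biwire A (Equiv.refl Z.r) (Equiv.refl Z.l)))
      (RoClass.comp (RoClass.biwire A (Equiv.sumAssoc W.r (X.r ⊕ Y.r) Z.r)
          (Equiv.sumAssoc Z.l (Y.l ⊕ X.l) W.l))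
        (RoClass.tensor (RoClass.biwire A (Equiv.refl W.r) (Equiv.refl W.l))
          (RoClass.biwire A (Equiv.sumAssoc X.r Y.r Z.r) (Equiv.sumAssoc Z.l Y.l X.l)))) =
      RoClass.comp (RoClass.biwire A (Equiv.sumAssoc (W.r ⊕ X.r) Y.r Z.r)
          (Equiv.sumAssoc Z.l Y.l (X.l ⊕ W.l)))
        (RoClass.biwire A (Equiv.sumAssoc W.r X.r (Y.r ⊕ Z.r))
          (Equiv.sumAssoc (Z.l ⊕ Y.l) X.l W.l))
    simp only [RoClass.biwire_tensor_biwire, RoClass.biwire_comp_biwire]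
    refine RoClass.biwire_congr ?_ ?_ <;> rintro (((x | x) | x) | x) <;> rfl
  triangle X Y := by
    change RoClass.comp (RoClass.biwire A (Equiv.sumAssoc X.r Empty Y.r)
          (Equiv.sumAssoc Y.l Empty X.l))
        (RoClass.tensor (RoClass.biwire A (Equiv.refl X.r) (Equiv.refl X.l))
          (RoClass.biwire A (Equiv.emptySum Empty Y.r) (Equiv.sumEmpty Y.l Empty).symm)) =
      RoClass.tensor (RoClass.biwire A (Equiv.sumEmpty X.r Empty) (Equiv.emptySum Empty X.l).symm)
        (RoClass.biwire A (Equiv.refl Y.r) (Equiv.refl Y.l))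
    simp only [RoClass.biwire_tensor_biwire, RoClass.biwire_comp_biwire]
    refine RoClass.biwire_congr ?_ ?_
    · rintro ((x | x) | x)
      · rfl
      · exact x.elim
      · rfl
    · rintro (x | x) <;> rfl

noncomputable instance symmetric : SymmetricCategory (OpenEnds A) where
  braiding X Y := isoOfEquiv (Equiv.sumComm X.r Y.r) (Equiv.sumComm X.l Y.l)
  braiding_naturality_right X _ _ f := RoClass.tensor_comp_braiding _ f
  braiding_naturality_left f Z := RoClass.tensor_comp_braiding f _
  hexagon_forward X Y Z := by
    change RoClass.comp (RoClass.biwire A (Equiv.sumAssoc X.r Y.r Z.r)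
        (Equiv.sumAssoc Z.l Y.l X.l)) (RoClass.comp
        (RoClass.biwire A (Equiv.sumComm X.r (Y.r ⊕ Z.r)) (Equiv.sumComm X.l (Z.l ⊕ Y.l)))
        (RoClass.biwire A (Equiv.sumAssoc Y.r Z.r X.r) (Equiv.sumAssoc X.l Z.l Y.l))) =
      RoClass.comp (RoClass.tensor (RoClass.biwire A (Equiv.sumComm X.r Y.r)
        (Equiv.sumComm X.l Y.l)) (RoClass.biwire A (Equiv.refl Z.r) (Equiv.refl Z.l)))
        (RoClass.comp (RoClass.biwire A (Equiv.sumAssoc Y.r X.r Z.r)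
          (Equiv.sumAssoc Z.l X.l Y.l))
        (RoClass.tensor (RoClass.biwire A (Equiv.refl Y.r) (Equiv.refl Y.l))
          (RoClass.biwire A (Equiv.sumComm X.r Z.r) (Equiv.sumComm X.l Z.l))))
    simp only [RoClass.biwire_tensor_biwire, RoClass.biwire_comp_biwire]
    refine RoClass.biwire_congr ?_ ?_ <;> rintro ((x | x) | x) <;> rfl
  hexagon_reverse X Y Z := by
    change RoClass.comp (RoClass.biwire A (Equiv.sumAssoc X.r Y.r Z.r).symm
        (Equiv.sumAssoc Z.l Y.l X.l).symm) (RoClass.comp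
        (RoClass.biwire A (Equiv.sumComm (X.r ⊕ Y.r) Z.r) (Equiv.sumComm (Y.l ⊕ X.l) Z.l))
        (RoClass.biwire A (Equiv.sumAssoc Z.r X.r Y.r).symm (Equiv.sumAssoc Y.l X.l Z.l).symm)) =
      RoClass.comp (RoClass.tensor (RoClass.biwire A (Equiv.refl X.r) (Equiv.refl X.l))
        (RoClass.biwire A (Equiv.sumComm Y.r Z.r) (Equiv.sumComm Y.l Z.l)))
        (RoClass.comp (RoClass.biwire A (Equiv.sumAssoc X.r Z.r Y.r).symm
          (Equiv.sumAssoc Y.l Z.l X.l).symm)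
        (RoClass.tensor (RoClass.biwire A (Equiv.sumComm X.r Z.r) (Equiv.sumComm X.l Z.l))
          (RoClass.biwire A (Equiv.refl Y.r) (Equiv.refl Y.l))))
    simp only [RoClass.biwire_tensor_biwire, RoClass.biwire_comp_biwire]
    refine RoClass.biwire_congr ?_ ?_ <;> rintro (x | (x | x)) <;> rfl
  symmetry X Y := by
    refine (RoClass.biwire_comp_biwire _ _ _ _).trans (RoClass.biwire_congr ?_ ?_) <;>
      rintro (x | x) <;> rfl

/-- The dual object: exchange the two directions. -/
def dual (X : OpenEnds A) : OpenEnds A := ⟨X.l, X.r⟩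

/-- The unit and the counit are identity wires; both zigzags reduce to following tokens. -/
noncomputable instance exactPairing (X : OpenEnds A) : ExactPairing X X.dual where
  coevaluation' := RoClass.unit A X.r X.l
  evaluation' := RoClass.counit A X.r X.l
  coevaluation_evaluation' := RoClass.zigzag_dual
  evaluation_coevaluation' := RoClass.zigzag

end OpenEnds

/-! ### Composites and sums with auxiliary wires -/

namespace RoClass

/-- Traces over loops in `L` and in `L'` agree if the loops correspond to each other through
bijections with a common type `K`. -/
theorem close_congr_of_map {A : Type u} {I I' J J' L L' K : Type} [Fintype J] [Fintype J']
    [Fintype L] [Fintype L'] {E : I ≃ L ⊕ I'} {F : J ≃ L ⊕ J'} {E' : I ≃ L' ⊕ I'}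
    {F' : J ≃ L' ⊕ J'} (k : L ≃ K) (k' : L' ≃ K)
    (hE : ∀ i, Sum.map k' id (E' i) = Sum.map k id (E i))
    (hF : ∀ j, Sum.map k' id (F' j) = Sum.map k id (F j)) (x : RoClass A I J) :
    close E' F' x = close E F x := by
  refine close_congr (k.trans k'.symm) (fun i => ?_) (fun j => ?_) x
  · apply (Sum.map_injective.2 ⟨k'.injective, Function.injective_id⟩)
    rw [hE]; cases E i <;> simp
  · apply (Sum.map_injective.2 ⟨k'.injective, Function.injective_id⟩)
    rw [hF]; cases F j <;> simp

/-- The loops of `sum (wire refl) (sum x y)`, when the wires carry the ends in `L''` and `L`. -/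
def compLoops (R' L L' L'' : Type) : (L ⊕ L'') ⊕ (L' ⊕ R') ≃ L' ⊕ ((R' ⊕ L'') ⊕ L) where
  toFun := Sum.elim (Sum.elim (fun l => .inr (.inr l)) fun l => .inr (.inl (.inr l)))
    (Sum.elim (fun l => .inl l) fun r => .inr (.inl (.inl r)))
  invFun := Sum.elim (fun l => .inr (.inl l))
    (Sum.elim (Sum.elim (fun r => .inr (.inr r)) fun l => .inl (.inr l)) fun l => .inl (.inl l))
  left_inv := by rintro ((x | x) | (x | x)) <;> rfl
  right_inv := by rintro (x | ((x | x) | x)) <;> rfl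

/-- The loops of `sum (wire refl) (sum x y)`, when the wires carry the ends in `R₁` and `L₁'` past
`x` and the ends in `R'` and `L` past `y`. -/
def tensorLoops (R' L R₁ L₁' : Type) :
    (R' ⊕ L) ⊕ (R₁ ⊕ L₁') ≃ (R' ⊕ (R₁ ⊕ L₁')) ⊕ L where
  toFun := Sum.elim (Sum.elim (fun r => .inl (.inl r)) .inr) fun x => .inl (.inr x)
  invFun := Sum.elim (Sum.elim (fun r => .inl (.inl r)) .inr) fun l => .inl (.inr l)
  left_inv := by rintro ((x | x) | x) <;> rfl
  right_inv := by rintro ((x | x) | x) <;> rfl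

/-- Wires on both sides of `x`, as wires on the left. -/
def sumWiresEnds (B I C : Type) : (B ⊕ C) ⊕ I ≃ (B ⊕ I) ⊕ C where
  toFun := Sum.elim (Sum.elim (fun b => .inl (.inl b)) .inr) fun i => .inl (.inr i)
  invFun := Sum.elim (Sum.elim (fun b => .inl (.inl b)) .inr) fun c => .inl (.inr c)
  left_inv := by rintro ((x | x) | x) <;> rfl
  right_inv := by rintro ((x | x) | x) <;> rfl

theorem wire_sum_sum_wire {A : Type u} {I J B C : Type} [Fintype J] [Fintype B] [Fintype C]
    (x : RoClass A I J) :
    sum (sum (wire A (Equiv.refl B)) x) (wire A (Equiv.refl C)) =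
      reindex (sumWiresEnds B I C) (sumWiresEnds B J C)
        (sum (wire A (Equiv.refl (B ⊕ C))) x) := by
  have h : wire A (Equiv.refl (B ⊕ C)) = sum (wire A (Equiv.refl B)) (wire A (Equiv.refl C)) := by
    rw [wire_sum_wire, Equiv.sumCongr_refl]
  rw [h, sum_comm (wire A _) x, sum_comm (sum (wire A (Equiv.refl B)) (wire A (Equiv.refl C))) x,
    sum_assoc, reindex_sum_left]
  simp only [reindex_reindex]
  refine reindex_congr ?_ ?_ _ <;> rintro ((x | x) | x) <;> rfl

section Formulas

variable {A : Type u} {R L R' L' R'' L'' R₁ L₁ R₁' L₁' K : Type}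
  [Fintype R] [Fintype L] [Fintype R'] [Fintype L'] [Fintype R''] [Fintype L'']
  [Fintype R₁] [Fintype L₁] [Fintype R₁'] [Fintype L₁'] [Fintype K]

/-- Composition with the auxiliary identity wires on `L''` and `L` that let the composite be
written with sequential compositions. The bijection `k` names the loops by the ends that are
connected; `hE` and `hF` say where the entrances and the exits go. -/
theorem close_wires_eq_comp (x : RoClass A (R ⊕ L') (R' ⊕ L))
    (y : RoClass A (R' ⊕ L'') (R'' ⊕ L')) (k : K ≃ L' ⊕ ((R' ⊕ L'') ⊕ L))
    (E : ((R ⊕ L') ⊕ L'') ⊕ ((R' ⊕ L'') ⊕ L) ≃ K ⊕ (R ⊕ L''))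
    (F : ((R' ⊕ L) ⊕ L'') ⊕ ((R'' ⊕ L') ⊕ L) ≃ K ⊕ (R'' ⊕ L))
    (hE : ∀ i, Sum.map k id (E i) = Sum.elim
      (Sum.elim (Sum.elim (fun r => .inr (.inl r)) fun l => .inl (.inl l)) fun l => .inr (.inr l))
      (fun i => .inl (.inr i)) i)
    (hF : ∀ j, Sum.map k id (F j) = Sum.elim
      (Sum.elim (Sum.elim (fun r => .inl (.inr (.inl (.inl r)))) fun l => .inl (.inr (.inr l)))
        fun l => .inl (.inr (.inl (.inr l))))
      (Sum.elim (Sum.elim (fun r => .inr (.inl r)) fun l => .inl (.inl l))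
        fun l => .inr (.inr l)) j) :
    close E F (sum (sum x (wire A (Equiv.refl L''))) (sum y (wire A (Equiv.refl L)))) =
      comp x y := by
  obtain ⟨z, hz⟩ : ∃ z : RoClass A (L'' ⊕ ((R ⊕ L') ⊕ R')) (L ⊕ (R' ⊕ (R'' ⊕ L'))),
      sum x y = reindex ((Equiv.sumComm _ _).trans (Equiv.sumAssoc _ _ _))
        ((Equiv.sumAssoc _ _ _).symm.trans ((Equiv.sumComm _ _).sumCongr (Equiv.refl _))) z :=
    ⟨reindex ((Equiv.sumComm _ _).trans (Equiv.sumAssoc _ _ _)).symm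
        ((Equiv.sumAssoc _ _ _).symm.trans ((Equiv.sumComm _ _).sumCongr (Equiv.refl _))).symm
        (sum x y), by
      rw [reindex_reindex, Equiv.symm_trans_self, Equiv.symm_trans_self, reindex_refl]⟩
  rw [comp, sum_sum_sum_comm, wire_sum_wire, hz, sum_comm, reindex_sum_right, close_reindex,
    close_reindex, close_reindex, close_reindex]
  conv_rhs => rw [← close_wire_sum z, close_close]
  rw [show (Equiv.refl L'').sumCongr (Equiv.refl L) = Equiv.refl _ by simp]
  refine close_congr_of_map (compLoops R' L L' L'') k ?_ ?_ _
  · rintro ((i | i) | (i | ((i | i) | i))) <;> exact hE _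
  · rintro ((j | j) | (j | (j | (j | j)))) <;> exact hF _

/-- Bidirectional sum written with sequential compositions: auxiliary identity wires carry the ends
of one arrow past the other one. The bijection `k` names the loops by the ends that are
connected. -/
theorem close_wires_eq_tensor (x : RoClass A (R ⊕ L') (R' ⊕ L))
    (y : RoClass A (R₁ ⊕ L₁') (R₁' ⊕ L₁)) (k : K ≃ (R' ⊕ (R₁ ⊕ L₁')) ⊕ L)
    (E : ((R₁ ⊕ (R ⊕ L')) ⊕ L₁') ⊕ ((R' ⊕ (R₁ ⊕ L₁')) ⊕ L) ≃ K ⊕ ((R ⊕ R₁) ⊕ (L₁' ⊕ L')))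
    (F : ((R₁ ⊕ (R' ⊕ L)) ⊕ L₁') ⊕ ((R' ⊕ (R₁' ⊕ L₁)) ⊕ L) ≃ K ⊕ ((R' ⊕ R₁') ⊕ (L₁ ⊕ L)))
    (hE : ∀ i, Sum.map k id (E i) = Sum.elim
      (Sum.elim (Sum.elim (fun r => .inr (.inl (.inr r)))
        (Sum.elim (fun r => .inr (.inl (.inl r))) fun l => .inr (.inr (.inr l))))
        fun l => .inr (.inr (.inl l)))
      (fun i => .inl i) i)
    (hF : ∀ j, Sum.map k id (F j) = Sum.elim
      (Sum.elim (Sum.elim (fun r => .inl (.inl (.inr (.inl r))))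
        (Sum.elim (fun r => .inl (.inl (.inl r))) fun l => .inl (.inr l)))
        fun l => .inl (.inl (.inr (.inr l))))
      (Sum.elim (Sum.elim (fun r => .inr (.inl (.inl r)))
        (Sum.elim (fun r => .inr (.inl (.inr r))) fun l => .inr (.inr (.inl l))))
        fun l => .inr (.inr (.inr l))) j) :
    close E F (sum (sum (sum (wire A (Equiv.refl R₁)) x) (wire A (Equiv.refl L₁')))
      (sum (sum (wire A (Equiv.refl R')) y) (wire A (Equiv.refl L)))) = tensor x y := by
  obtain ⟨z, hz⟩ : ∃ z : RoClass A ((R₁ ⊕ L₁') ⊕ (R ⊕ L')) ((R' ⊕ L) ⊕ (R₁' ⊕ L₁)),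
      sum x y = reindex (Equiv.sumComm _ _) (Equiv.refl _) z :=
    ⟨reindex (Equiv.sumComm _ _) (Equiv.refl _) (sum x y), by
      rw [reindex_reindex, ← Equiv.sumComm_symm, Equiv.symm_trans_self, Equiv.refl_trans,
        reindex_refl]⟩
  rw [tensor, wire_sum_sum_wire, wire_sum_sum_wire, sum_reindex, close_reindex,
    sum_sum_sum_comm, wire_sum_wire, hz, reindex_sum_right, close_reindex, close_reindex,
    reindex_reindex]
  conv_rhs => rw [← close_wire_sum z, reindex_close]
  rw [show (Equiv.refl (R₁ ⊕ L₁')).sumCongr (Equiv.refl (R' ⊕ L)) = Equiv.refl _ by simp]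
  refine close_congr_of_map (tensorLoops R' L R₁ L₁') k ?_ ?_ _
  · rintro (((i | i) | (i | i)) | ((i | i) | (i | i))) <;> exact hE _
  · rintro (((i | i) | (i | i)) | ((i | i) | (i | i))) <;> exact hF _

end Formulas

end RoClass

/-! ### Arrows between natural numbers -/

namespace RoArrow

variable {A : Type u} {m n k l : ℕ}

theorem id_eq_wire : RoArrow.id A m = RoClass.wire A (Equiv.refl _) := rfl

theorem swap_eq_wire : RoArrow.swap A m n = RoClass.wire A finAddFlip := rfl

theorem seq_eq (f : RoArrow A m k) (g : RoArrow A k n) : f.seq g = RoClass.seq f g := rfl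

theorem cast_eq_reindex {m' n' : ℕ} (hm : m = m') (hn : n = n') (f : RoArrow A m n) :
    f.cast hm hn = RoClass.reindex (finCongr hm) (finCongr hn) f := rfl

theorem trace_eq_close (f : RoArrow A (l + m) (l + n)) :
    f.trace l = RoClass.close finSumFinEquiv.symm finSumFinEquiv.symm f := rfl

theorem sum_eq_reindex (f : RoArrow A m n) (g : RoArrow A k l) :
    f.sum g = RoClass.reindex finSumFinEquiv finSumFinEquiv (RoClass.sum f g) := by
  induction f using Quotient.inductionOn
  induction g using Quotient.inductionOn
  rfl

/-- A bidirectional arrow of the category of open MDPs, with its rightward and leftward ends told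
apart. -/
def split {a b c d : ℕ} (f : RoArrow A (a + b) (c + d)) :
    RoClass A (Fin a ⊕ Fin b) (Fin c ⊕ Fin d) :=
  RoClass.reindex finSumFinEquiv.symm finSumFinEquiv.symm f

theorem reindex_split {a b c d : ℕ} (f : RoArrow A (a + b) (c + d)) :
    RoClass.reindex finSumFinEquiv finSumFinEquiv f.split = f := by
  rw [split, RoClass.reindex_reindex, Equiv.symm_trans_self, Equiv.symm_trans_self,
    RoClass.reindex_refl]

theorem split_reindex {a b c d : ℕ} (x : RoClass A (Fin a ⊕ Fin b) (Fin c ⊕ Fin d)) :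
    split (RoClass.reindex finSumFinEquiv finSumFinEquiv x) = x := by
  rw [split, RoClass.reindex_reindex, Equiv.self_trans_symm, Equiv.self_trans_symm,
    RoClass.reindex_refl]

theorem split_injective {a b c d : ℕ} :
    Function.Injective (split : RoArrow A (a + b) (c + d) → _) :=
  Function.LeftInverse.injective reindex_split

/-! The swap exchanges the summands. -/

theorem finAddFlip_left (i : Fin m) :
    finAddFlip (finSumFinEquiv (.inl i) : Fin (m + n)) = finSumFinEquiv (.inr i) := by
  simp [finAddFlip]

theorem finAddFlip_right (i : Fin n) :
    finAddFlip (finSumFinEquiv (.inr i) : Fin (m + n)) = finSumFinEquiv (.inl i) := by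
  simp [finAddFlip]

theorem finAddFlip_symm_left (i : Fin m) :
    finAddFlip.symm (finSumFinEquiv (.inl i) : Fin (m + n)) = finSumFinEquiv (.inr i) :=
  (Equiv.symm_apply_eq _).2 (finAddFlip_right i).symm

theorem finAddFlip_symm_right (i : Fin n) :
    finAddFlip.symm (finSumFinEquiv (.inr i) : Fin (m + n)) = finSumFinEquiv (.inl i) :=
  (Equiv.symm_apply_eq _).2 (finAddFlip_left i).symm

/-! The transports along `(m + n) + k = m + (n + k)` and `k + (m + n) + l = k + m + (n + l)` do not
change which end of which summand an index stands for. -/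

theorem finCongr_left_left (h : m + n + k = m + (n + k)) (i : Fin m) :
    finCongr h (finSumFinEquiv (.inl (finSumFinEquiv (.inl i)))) = finSumFinEquiv (.inl i) :=
  Fin.ext rfl

theorem finCongr_left_right (h : m + n + k = m + (n + k)) (i : Fin n) :
    finCongr h (finSumFinEquiv (.inl (finSumFinEquiv (.inr i)))) =
      finSumFinEquiv (.inr (finSumFinEquiv (.inl i))) :=
  Fin.ext rfl

theorem finCongr_right (h : m + n + k = m + (n + k)) (i : Fin k) :
    finCongr h (finSumFinEquiv (.inr i)) = finSumFinEquiv (.inr (finSumFinEquiv (.inr i))) :=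
  Fin.ext (Nat.add_assoc _ _ _)

theorem finCongr_left' (h : m + (n + k) = m + n + k) (i : Fin m) :
    finCongr h (finSumFinEquiv (.inl i)) = finSumFinEquiv (.inl (finSumFinEquiv (.inl i))) :=
  Fin.ext rfl

theorem finCongr_right_left (h : m + (n + k) = m + n + k) (i : Fin n) :
    finCongr h (finSumFinEquiv (.inr (finSumFinEquiv (.inl i)))) =
      finSumFinEquiv (.inl (finSumFinEquiv (.inr i))) :=
  Fin.ext rfl

theorem finCongr_right_right (h : m + (n + k) = m + n + k) (i : Fin k) :
    finCongr h (finSumFinEquiv (.inr (finSumFinEquiv (.inr i)))) = finSumFinEquiv (.inr i) :=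
  Fin.ext (Nat.add_assoc _ _ _).symm

/-- The composition of open MDPs is the closing of the middle ends of a sum. After the wirings in
its definition have been absorbed into renamings, and sequential compositions and traces into a
single closing, it remains to compute where each end goes. -/
theorem split_seq {X Y Z : OMDP A} (f : OMDP.Arrow X Y) (g : OMDP.Arrow Y Z) :
    split (OMDP.seq f g) = RoClass.comp (split f) (split g) := by
  obtain ⟨x, rfl⟩ : ∃ x, f = RoClass.reindex finSumFinEquiv finSumFinEquiv x :=
    ⟨_, (reindex_split f).symm⟩
  obtain ⟨y, rfl⟩ : ∃ y, g = RoClass.reindex finSumFinEquiv finSumFinEquiv y :=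
    ⟨_, (reindex_split g).symm⟩
  rw [split_reindex, split_reindex, OMDP.seq, trace_eq_close]
  simp only [cast_eq_reindex, seq_eq, sum_eq_reindex, id_eq_wire, swap_eq_wire,
    RoClass.reindex_sum_left, RoClass.wire_sum_wire, RoClass.reindex_wire, RoClass.wire_seq,
    RoClass.seq_wire, RoClass.reindex_reindex]
  simp only [RoClass.seq_eq_close, RoClass.sum_reindex,
    RoClass.close_reindex, RoClass.reindex_close, RoClass.close_close, split]
  refine RoClass.close_wires_eq_comp x y ((Equiv.sumComm _ _).trans ((Equiv.refl _).sumCongr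
    (finSumFinEquiv.symm.trans (finSumFinEquiv.symm.sumCongr (Equiv.refl _))))) _ _ ?_ ?_
  · rintro (((i | i) | i) | ((i | i) | i)) <;>
      simp only [Equiv.trans_apply, Equiv.sumCongr_apply, Equiv.symm_trans_apply,
        Equiv.sumCongr_symm, Equiv.symm_symm, Equiv.refl_symm, Equiv.coe_refl, Sum.map_inl,
        Sum.map_inr, id_eq, Equiv.symm_apply_apply, Equiv.sumComm_apply,
        Sum.swap_inl, Sum.swap_inr, Sum.elim_inl, Sum.elim_inr, Equiv.sumAssoc_symm_apply_inl,
        Equiv.sumAssoc_symm_apply_inr_inl, Equiv.sumAssoc_symm_apply_inr_inr,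
        finAddFlip_symm_left, finAddFlip_symm_right,
        finCongr_left_left, finCongr_left_right, finCongr_right]
  · rintro (((i | i) | i) | ((i | i) | i)) <;>
      simp only [Equiv.trans_apply, Equiv.sumCongr_apply, Equiv.coe_refl, Sum.map_inl,
        Sum.map_inr, id_eq, Equiv.symm_apply_apply, Equiv.sumComm_apply,
        Sum.swap_inl, Sum.swap_inr, Sum.elim_inl, Sum.elim_inr, Equiv.sumAssoc_symm_apply_inl,
        Equiv.sumAssoc_symm_apply_inr_inl, Equiv.sumAssoc_symm_apply_inr_inr,
        finAddFlip_left, finAddFlip_right, finCongr_symm, finCongr_left_left,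
        finCongr_left_right, finCongr_right, finCongr_left', finCongr_right_left,
        finCongr_right_right]

theorem finCongr_left_left_four (h : k + (m + n) + l = k + m + (n + l)) (i : Fin k) :
    finCongr h (finSumFinEquiv (.inl (finSumFinEquiv (.inl i)))) =
      finSumFinEquiv (.inl (finSumFinEquiv (.inl i))) :=
  Fin.ext rfl

theorem finCongr_left_right_left_four (h : k + (m + n) + l = k + m + (n + l)) (i : Fin m) :
    finCongr h (finSumFinEquiv (.inl (finSumFinEquiv (.inr (finSumFinEquiv (.inl i)))))) =
      finSumFinEquiv (.inl (finSumFinEquiv (.inr i))) :=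
  Fin.ext rfl

theorem finCongr_left_right_right_four (h : k + (m + n) + l = k + m + (n + l)) (i : Fin n) :
    finCongr h (finSumFinEquiv (.inl (finSumFinEquiv (.inr (finSumFinEquiv (.inr i)))))) =
      finSumFinEquiv (.inr (finSumFinEquiv (.inl i))) :=
  Fin.ext (Nat.add_assoc _ _ _).symm

theorem finCongr_right_four (h : k + (m + n) + l = k + m + (n + l)) (i : Fin l) :
    finCongr h (finSumFinEquiv (.inr i)) = finSumFinEquiv (.inr (finSumFinEquiv (.inr i))) :=
  Fin.ext (by simp [Nat.add_assoc])

/-- The sum of open MDPs is the bidirectional sum: in its definition, each of the two arrows is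
composed with wires only. -/
theorem split_sum {X Y Z W : OMDP A} (f : OMDP.Arrow X Y) (g : OMDP.Arrow Z W) :
    split (a := X.r + Z.r) (b := W.l + Y.l) (c := Y.r + W.r) (d := Z.l + X.l) (OMDP.sum f g) =
      RoClass.reindex (finSumFinEquiv.sumCongr finSumFinEquiv)
        (finSumFinEquiv.sumCongr finSumFinEquiv) (RoClass.tensor (split f) (split g)) := by
  obtain ⟨x, rfl⟩ : ∃ x, f = RoClass.reindex finSumFinEquiv finSumFinEquiv x :=
    ⟨_, (reindex_split f).symm⟩
  obtain ⟨y, rfl⟩ : ∃ y, g = RoClass.reindex finSumFinEquiv finSumFinEquiv y :=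
    ⟨_, (reindex_split g).symm⟩
  rw [split_reindex, split_reindex]
  suffices h : RoClass.reindex (finSumFinEquiv.sumCongr finSumFinEquiv).symm
      (finSumFinEquiv.sumCongr finSumFinEquiv).symm (split (a := X.r + Z.r) (b := W.l + Y.l)
        (c := Y.r + W.r) (d := Z.l + X.l) (OMDP.sum
        (RoClass.reindex finSumFinEquiv finSumFinEquiv x)
        (RoClass.reindex finSumFinEquiv finSumFinEquiv y))) = RoClass.tensor x y by
    rw [← h, RoClass.reindex_reindex, Equiv.symm_trans_self, Equiv.symm_trans_self,
      RoClass.reindex_refl]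
  change RoClass.reindex _ _ (split (RoArrow.seq (m := X.r + Z.r + (W.l + Y.l))
    (n := Y.r + W.r + (Z.l + X.l)) _ _)) = _
  simp only [cast_eq_reindex, seq_eq, sum_eq_reindex, id_eq_wire, swap_eq_wire,
    RoClass.reindex_sum_left, RoClass.reindex_sum_right, RoClass.wire_sum_wire,
    RoClass.reindex_wire, RoClass.wire_seq, RoClass.seq_wire, RoClass.reindex_reindex]
  simp only [RoClass.seq_eq_close, RoClass.sum_reindex,
    RoClass.close_reindex, RoClass.reindex_close, split]
  refine RoClass.close_wires_eq_tensor x y (finSumFinEquiv.symm.trans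
    ((finSumFinEquiv.symm.sumCongr finSumFinEquiv.symm).trans ((Equiv.sumAssoc _ _ _).symm.trans
      ((Equiv.sumAssoc _ _ _).sumCongr (Equiv.refl _))))) _ _ ?_ ?_
  · rintro (((i | (i | i)) | i) | ((i | (i | i)) | i)) <;>
      simp only [Equiv.trans_apply, Equiv.sumCongr_apply, Equiv.symm_trans_apply,
        Equiv.sumCongr_symm, Equiv.symm_symm, Equiv.coe_refl, Sum.map_inl,
        Sum.map_inr, id_eq, Equiv.symm_apply_apply, Equiv.sumComm_apply,
        Sum.swap_inl, Sum.swap_inr, Sum.elim_inl, Sum.elim_inr, Equiv.sumAssoc_symm_apply_inl,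
        Equiv.sumAssoc_symm_apply_inr_inl, Equiv.sumAssoc_symm_apply_inr_inr,
        Equiv.sumAssoc_apply_inl_inl, Equiv.sumAssoc_apply_inl_inr, Equiv.sumAssoc_apply_inr,
        finAddFlip_symm_left, finAddFlip_symm_right, finCongr_left_left_four,
        finCongr_left_right_left_four, finCongr_left_right_right_four, finCongr_right_four]
  · rintro (((i | (i | i)) | i) | ((i | (i | i)) | i)) <;>
      simp only [Equiv.trans_apply, Equiv.sumCongr_apply,
        Equiv.sumCongr_symm, Equiv.coe_refl, Sum.map_inl,
        Sum.map_inr, id_eq, Equiv.symm_apply_apply, Sum.elim_inl, Sum.elim_inr,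
        Equiv.sumAssoc_symm_apply_inl,
        Equiv.sumAssoc_symm_apply_inr_inl, Equiv.sumAssoc_symm_apply_inr_inr,
        Equiv.sumAssoc_apply_inl_inl, Equiv.sumAssoc_apply_inl_inr, Equiv.sumAssoc_apply_inr,
        finAddFlip_left, finAddFlip_right, finCongr_left_left_four,
        finCongr_left_right_left_four, finCongr_left_right_right_four, finCongr_right_four]

end RoArrow

/-! ### Transport to the category of open MDPs -/

namespace RoArrow

variable {A : Type u}

theorem split_wire {a b c d : ℕ} (e : Fin (a + b) ≃ Fin (c + d)) (e' : Fin a ≃ Fin c)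
    (e'' : Fin b ≃ Fin d) (hl : ∀ i, e (finSumFinEquiv (.inl i)) = finSumFinEquiv (.inl (e' i)))
    (hr : ∀ i, e (finSumFinEquiv (.inr i)) = finSumFinEquiv (.inr (e'' i))) :
    split (RoClass.wire A e) = RoClass.biwire A e' e'' := by
  rw [split, RoClass.reindex_wire, RoClass.biwire]
  congr 1
  ext1 i
  rcases i with i | i <;> simp only [Equiv.trans_apply, Equiv.symm_symm, hl, hr,
    Equiv.symm_apply_apply, Equiv.sumCongr_apply, Sum.map_inl, Sum.map_inr]

theorem split_id (a b : ℕ) :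
    split (RoArrow.id A (a + b)) = RoClass.biwire A (Equiv.refl (Fin a)) (Equiv.refl (Fin b)) :=
  split_wire _ _ _ (fun _ => rfl) fun _ => rfl

theorem finAddFlip_finAddFlip {m n : ℕ} (i : Fin (m + n)) :
    finAddFlip (finAddFlip i) = i := by
  obtain ⟨i, rfl⟩ := finSumFinEquiv.surjective i
  rcases i with i | i <;> simp only [finAddFlip_left, finAddFlip_right]

theorem finSumFinEquiv_symm_finAddFlip {m n : ℕ} (i : Fin (m + n)) :
    finSumFinEquiv.symm (finAddFlip i) = Sum.swap (finSumFinEquiv.symm i) := by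
  simp [finAddFlip]

theorem finSumFinEquiv_symm_finCongr_left {n : ℕ} (i : Fin n) (h : n + 0 = 0 + n) :
    finSumFinEquiv.symm (finCongr h (finSumFinEquiv (.inl i))) = .inr i :=
  (Equiv.symm_apply_eq _).2 (Fin.ext (Nat.zero_add _).symm)

theorem finSumFinEquiv_symm_finCongr_right {n : ℕ} (i : Fin n) (h : 0 + n = n + 0) :
    finSumFinEquiv.symm (finCongr h (finSumFinEquiv (.inr i))) = .inl i :=
  (Equiv.symm_apply_eq _).2 (Fin.ext (Nat.zero_add _))

/-- The associator of `OpenEnds`, conjugated with the bijections `Fin m ⊕ Fin n ≃ Fin (m + n)`, does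
not change the value of an index. -/
theorem finCongr_add_assoc {m n k : ℕ} (h : m + n + k = m + (n + k)) (i : Fin (m + n + k)) :
    finCongr h i = ((finSumFinEquiv.symm.trans (finSumFinEquiv.symm.sumCongr
      (Equiv.refl (Fin k)))).trans ((Equiv.sumAssoc (Fin m) (Fin n) (Fin k)).trans
        (((Equiv.refl (Fin m)).sumCongr finSumFinEquiv).trans finSumFinEquiv))) i := by
  obtain ⟨i, rfl⟩ := finSumFinEquiv.surjective i
  rcases i with i | i
  · obtain ⟨i, rfl⟩ := finSumFinEquiv.surjective i
    rcases i with i | i <;>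
      simp only [Equiv.trans_apply, Equiv.sumCongr_apply, Equiv.symm_apply_apply, Sum.map_inl,
        Sum.map_inr, Equiv.coe_refl, id_eq, Equiv.sumAssoc_apply_inl_inl,
        Equiv.sumAssoc_apply_inl_inr, finCongr_left_left, finCongr_left_right]
  · simp only [Equiv.trans_apply, Equiv.sumCongr_apply, Equiv.symm_apply_apply, Sum.map_inr,
      Equiv.coe_refl, id_eq, Equiv.sumAssoc_apply_inr, finCongr_right]

end RoArrow

namespace OMDP

variable (A : Type u)

/-- `RoArrow.split` is injective, and turns the identities and `;` into those of `OpenEnds A`. -/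
theorem isCategory : IsCategory A :=
  ⟨{ categoryStruct A with
      id_comp := fun {X Y} f => RoArrow.split_injective <| by
        refine (RoArrow.split_seq _ _).trans ?_
        change RoClass.comp (RoArrow.split (RoArrow.id A (X.r + X.l))) _ = _
        rw [RoArrow.split_id, RoClass.id_comp]
      comp_id := fun {X Y} f => RoArrow.split_injective <| by
        refine (RoArrow.split_seq _ _).trans ?_
        change RoClass.comp _ (RoArrow.split (RoArrow.id A (Y.r + Y.l))) = _
        rw [RoArrow.split_id, RoClass.comp_id]
      assoc := fun f g h => RoArrow.split_injective <| by
        refine ((RoArrow.split_seq _ _).trans (congrArg (RoClass.comp · _)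
          (RoArrow.split_seq f g))).trans (Eq.trans (RoClass.comp_assoc _ _ _) ?_)
        exact ((RoArrow.split_seq _ _).trans (congrArg (RoClass.comp _)
          (RoArrow.split_seq g h))).symm }, rfl⟩

noncomputable instance instCategory : Category.{max u 1} (OMDP A) := category (isCategory A)

noncomputable instance instMonoidalStruct : MonoidalCategoryStruct (OMDP A) :=
  monoidalStruct (isCategory A)

/-- The faithful functor along which the structure of `OpenEnds A` is pulled back: an object becomes
the types `Fin r` and `Fin l` of its ends, and an arrow is split. -/
noncomputable def toOpenEnds : OMDP A ⥤ OpenEnds A where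
  obj X := ⟨Fin X.r, Fin X.l⟩
  map f := RoArrow.split f
  map_id X := RoArrow.split_id X.r X.l
  map_comp f g := RoArrow.split_seq f g

instance : (toOpenEnds A).Faithful where
  map_injective h := RoArrow.split_injective h

/-- An equality of objects is sent to the renaming of `Fin m` to `Fin n` for equal `m` and `n`. -/
theorem toOpenEnds_map_eqToHom {X Y : OMDP A} (h : X = Y) :
    (toOpenEnds A).map (eqToHom h) =
      RoClass.biwire A (finCongr (congrArg OMDP.r h)) (finCongr (congrArg OMDP.l h.symm)) := by
  subst h
  exact (toOpenEnds A).map_id X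

variable {A} in
theorem add_assoc (X Y Z : OMDP A) : (X.add Y).add Z = X.add (Y.add Z) :=
  OMDP.ext (Nat.add_assoc _ _ _) (Nat.add_assoc _ _ _).symm

variable {A} in
theorem zero_add (X : OMDP A) : (zero A).add X = X :=
  OMDP.ext (Nat.zero_add _) (Nat.add_zero _)

variable {A} in
theorem add_zero (X : OMDP A) : X.add (zero A) = X :=
  OMDP.ext (Nat.add_zero _) (Nat.zero_add _)

theorem split_sum_eq_comp {X Y Z W : OMDP A} (f : Arrow X Y) (g : Arrow Z W) :
    RoArrow.split (a := X.r + Z.r) (b := W.l + Y.l) (c := Y.r + W.r) (d := Z.l + X.l) (sum f g) =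
      RoClass.comp (RoClass.biwire A finSumFinEquiv.symm finSumFinEquiv)
        (RoClass.comp (RoClass.tensor (RoArrow.split f) (RoArrow.split g))
          (RoClass.biwire A finSumFinEquiv finSumFinEquiv.symm)) := by
  rw [RoArrow.split_sum, RoClass.biwire_comp, RoClass.comp_biwire, RoClass.reindex_reindex]
  exact RoClass.reindex_congr (by rintro (i | i) <;> rfl) (by rintro (i | i) <;> rfl) _

open Monoidal in
/-- The functor to `OpenEnds A` preserves the tensor product, up to the bijections
`Fin m ⊕ Fin n ≃ Fin (m + n)`, and sends the identities that serve as associators and unitors to the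
associators and unitors. -/
noncomputable def inducingData : InducingFunctorData (toOpenEnds A) where
  μIso X Y := OpenEnds.isoOfEquiv (X := ⟨Fin X.r ⊕ Fin Y.r, Fin Y.l ⊕ Fin X.l⟩)
    (Y := ⟨Fin (X.r + Y.r), Fin (Y.l + X.l)⟩) finSumFinEquiv finSumFinEquiv.symm
  whiskerLeft_eq X _ _ f := by
    refine (split_sum_eq_comp A (X := X) (Y := X) (RoArrow.id A (X.r + X.l)) f).trans ?_
    rw [RoArrow.split_id]
    rfl
  whiskerRight_eq f X := by
    refine (split_sum_eq_comp A (Z := X) (W := X) f (RoArrow.id A (X.r + X.l))).trans ?_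
    rw [RoArrow.split_id]
    rfl
  tensorHom_eq f g := split_sum_eq_comp A f g
  εIso := OpenEnds.isoOfEquiv (X := ⟨Empty, Empty⟩) (Y := ⟨Fin 0, Fin 0⟩)
    (Equiv.equivOfIsEmpty Empty (Fin 0)) (Equiv.equivOfIsEmpty (Fin 0) Empty)
  associator_eq X Y Z := by
    refine (toOpenEnds_map_eqToHom A (add_assoc X Y Z)).trans ?_
    change RoClass.biwire A (finCongr _) (finCongr _) = RoClass.comp (RoClass.comp
      (RoClass.biwire A finSumFinEquiv.symm finSumFinEquiv)
      (RoClass.tensor (RoClass.biwire A finSumFinEquiv.symm finSumFinEquiv)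
        (RoClass.biwire A (Equiv.refl (Fin Z.r)) (Equiv.refl (Fin Z.l)))))
      (RoClass.comp (RoClass.biwire A (Equiv.sumAssoc (Fin X.r) (Fin Y.r) (Fin Z.r))
          (Equiv.sumAssoc (Fin Z.l) (Fin Y.l) (Fin X.l)))
        (RoClass.comp (RoClass.tensor (RoClass.biwire A (Equiv.refl (Fin X.r))
          (Equiv.refl (Fin X.l))) (RoClass.biwire A finSumFinEquiv finSumFinEquiv.symm))
        (RoClass.biwire A finSumFinEquiv finSumFinEquiv.symm)))
    simp only [RoClass.biwire_tensor_biwire, RoClass.biwire_comp_biwire]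
    exact RoClass.biwire_congr (RoArrow.finCongr_add_assoc _) (RoArrow.finCongr_add_assoc _)
  leftUnitor_eq X := by
    refine (toOpenEnds_map_eqToHom A (zero_add X)).trans ?_
    change RoClass.biwire A (finCongr _) (finCongr _) = RoClass.comp (RoClass.comp
      (RoClass.biwire A finSumFinEquiv.symm finSumFinEquiv)
      (RoClass.tensor (RoClass.biwire A (Equiv.equivOfIsEmpty (Fin 0) Empty)
        (Equiv.equivOfIsEmpty Empty (Fin 0)))
        (RoClass.biwire A (Equiv.refl (Fin X.r)) (Equiv.refl (Fin X.l)))))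
      (RoClass.biwire A (Equiv.emptySum Empty (Fin X.r)) (Equiv.sumEmpty (Fin X.l) Empty).symm)
    simp only [RoClass.biwire_tensor_biwire, RoClass.biwire_comp_biwire]
    refine RoClass.biwire_congr (fun i => ?_) (fun _ => Fin.ext rfl)
    · obtain ⟨i, rfl⟩ := finSumFinEquiv.surjective i
      rcases i with i | i
      · exact i.elim0
      · simp only [Equiv.trans_apply, Equiv.symm_apply_apply]
        exact Fin.ext (Nat.zero_add _)
  rightUnitor_eq X := by
    refine (toOpenEnds_map_eqToHom A (add_zero X)).trans ?_
    change RoClass.biwire A (finCongr _) (finCongr _) = RoClass.comp (RoClass.comp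
      (RoClass.biwire A finSumFinEquiv.symm finSumFinEquiv)
      (RoClass.tensor (RoClass.biwire A (Equiv.refl (Fin X.r)) (Equiv.refl (Fin X.l)))
        (RoClass.biwire A (Equiv.equivOfIsEmpty (Fin 0) Empty)
        (Equiv.equivOfIsEmpty Empty (Fin 0)))))
      (RoClass.biwire A (Equiv.sumEmpty (Fin X.r) Empty) (Equiv.emptySum Empty (Fin X.l)).symm)
    simp only [RoClass.biwire_tensor_biwire, RoClass.biwire_comp_biwire]
    refine RoClass.biwire_congr (fun i => ?_) (fun _ => Fin.ext (Nat.zero_add _).symm)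
    · obtain ⟨i, rfl⟩ := finSumFinEquiv.surjective i
      rcases i with i | i
      · simp only [Equiv.trans_apply, Equiv.symm_apply_apply]
        exact Fin.ext rfl
      · exact i.elim0

theorem isMonoidal : IsMonoidal (isCategory A) :=
  ⟨Monoidal.induced (toOpenEnds A) (inducingData A), rfl⟩

noncomputable instance instMonoidal : MonoidalCategory (OMDP A) :=
  monoidal (isCategory A) (isMonoidal A)

noncomputable instance : (toOpenEnds A).Monoidal :=
  Monoidal.fromInducedMonoidal (toOpenEnds A) (inducingData A)

variable {A}

theorem split_swap (X Y : OMDP A) : RoArrow.split (a := X.r + Y.r) (b := X.l + Y.l)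
    (c := Y.r + X.r) (d := Y.l + X.l) (swap X Y) = RoClass.biwire A finAddFlip finAddFlip := by
  change RoArrow.split (RoArrow.sum (RoArrow.swap A X.r Y.r) (RoArrow.swap A X.l Y.l)) = _
  rw [RoArrow.sum_eq_reindex, RoArrow.split_reindex, RoArrow.swap_eq_wire, RoArrow.swap_eq_wire,
    RoClass.wire_sum_wire]
  rfl

theorem split_unit (X : OMDP A) : RoArrow.split (a := 0) (b := X.r + X.l)
    (c := X.r + X.l) (d := 0) (unit X) =
    RoClass.wire A ((finSumFinEquiv.trans (finCongr (by simp))).trans finSumFinEquiv.symm) := by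
  change RoArrow.split (RoArrow.cast (Nat.zero_add _).symm (Nat.add_zero _).symm
    (RoArrow.id A (X.r + X.l))) = _
  rw [RoArrow.cast_eq_reindex, RoArrow.id_eq_wire, RoClass.reindex_wire, RoArrow.split,
    RoClass.reindex_wire]
  congr 1

theorem split_counit (X : OMDP A) : RoArrow.split (a := X.l + X.r) (b := 0)
    (c := 0) (d := X.l + X.r) (counit X) =
    RoClass.wire A ((finSumFinEquiv.trans (finCongr (by simp))).trans finSumFinEquiv.symm) := by
  change RoArrow.split (RoArrow.cast (Nat.add_zero _).symm (Nat.zero_add _).symm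
    (RoArrow.id A (X.l + X.r))) = _
  rw [RoArrow.cast_eq_reindex, RoArrow.id_eq_wire, RoClass.reindex_wire, RoArrow.split,
    RoClass.reindex_wire]
  congr 1

/-- The swap is its own inverse. -/
noncomputable def swapIso (X Y : OMDP A) : X ⊗ Y ≅ Y ⊗ X where
  hom := swap X Y
  inv := swap Y X
  hom_inv_id := (toOpenEnds A).map_injective <| by
    rw [Functor.map_comp, CategoryTheory.Functor.map_id]
    refine (congrArg₂ RoClass.comp (split_swap X Y) (split_swap Y X)).trans
      ((RoClass.biwire_comp_biwire _ _ _ _).trans (RoClass.biwire_congr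
        RoArrow.finAddFlip_finAddFlip RoArrow.finAddFlip_finAddFlip))
  inv_hom_id := (toOpenEnds A).map_injective <| by
    rw [Functor.map_comp, CategoryTheory.Functor.map_id]
    refine (congrArg₂ RoClass.comp (split_swap Y X) (split_swap X Y)).trans
      ((RoClass.biwire_comp_biwire _ _ _ _).trans (RoClass.biwire_congr
        RoArrow.finAddFlip_finAddFlip RoArrow.finAddFlip_finAddFlip))

/-- The symmetry is the swap, which is sent to the symmetry of `OpenEnds A`. -/
noncomputable instance instSymmetric : SymmetricCategory (OMDP A) where
  toBraidedCategory := BraidedCategory.ofFaithful (toOpenEnds A) swapIso fun X Y => by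
    refine (congrArg (RoClass.comp (RoClass.biwire A finSumFinEquiv finSumFinEquiv.symm))
      (split_swap X Y)).trans ((RoClass.biwire_comp_biwire _ _ _ _).trans
      (Eq.trans (RoClass.biwire_congr ?_ ?_) (RoClass.biwire_comp_biwire _ _ _ _).symm))
    · rintro (i | i)
      · exact RoArrow.finAddFlip_left i
      · exact RoArrow.finAddFlip_right i
    · exact RoArrow.finSumFinEquiv_symm_finAddFlip
  symmetry X Y := (swapIso X Y).hom_inv_id

/-- The dual pairing with the unit and counit of open MDPs, which are sent to those of
`OpenEnds A`. -/
noncomputable instance instExactPairing (X : OMDP A) : ExactPairing X X.dual :=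
  letI : ExactPairing ((toOpenEnds A).obj X) ((toOpenEnds A).obj X.dual) :=
    OpenEnds.exactPairing ((toOpenEnds A).obj X)
  ExactPairing.ofFaithful (toOpenEnds A) (counit X) (unit X)
    (by
      refine (split_counit X).trans ?_
      change _ = RoClass.comp (RoClass.biwire A finSumFinEquiv.symm finSumFinEquiv)
        (RoClass.comp (RoClass.counit A (Fin X.r) (Fin X.l))
          (RoClass.biwire A (Equiv.equivOfIsEmpty Empty (Fin 0))
            (Equiv.equivOfIsEmpty (Fin 0) Empty)))
      rw [RoClass.biwire_comp, RoClass.comp_biwire, RoClass.counit, RoClass.reindex_wire,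
        RoClass.reindex_wire]
      congr 1
      ext1 i
      rcases i with i | i
      · exact (RoArrow.finSumFinEquiv_symm_finCongr_left i (by simp)).trans
          (congrArg Sum.inr (Equiv.apply_symm_apply finSumFinEquiv i).symm)
      · exact i.elim0)
    (by
      refine (split_unit X).trans ?_
      change _ = RoClass.comp
        (RoClass.biwire A (Equiv.equivOfIsEmpty (Fin 0) Empty)
            (Equiv.equivOfIsEmpty Empty (Fin 0)))
        (RoClass.comp (RoClass.unit A (Fin X.r) (Fin X.l))
          (RoClass.biwire A finSumFinEquiv finSumFinEquiv.symm))
      rw [RoClass.biwire_comp, RoClass.comp_biwire, RoClass.unit, RoClass.reindex_wire,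
        RoClass.reindex_wire]
      congr 1
      ext1 i
      rcases i with i | i
      · exact i.elim0
      · exact (RoArrow.finSumFinEquiv_symm_finCongr_right i (by simp)).trans
          (congrArg Sum.inl (Equiv.apply_symm_apply finSumFinEquiv i).symm))

/-- The dual is both a right and a left dual, because `X.dual.dual` is `X`. -/
noncomputable instance instRigid : RigidCategory (OMDP A) where
  rightDual X := ⟨X.dual⟩
  leftDual X := { leftDual := X.dual, exact := instExactPairing X.dual }

end OMDP

theorem mainTheorem5 (A : Type u) [Finite A] [Nonempty A] :
    ∃ hC : OMDP.IsCategory A,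
      letI := OMDP.category hC
      ∃ hM : OMDP.IsMonoidal hC,
        letI := OMDP.monoidal hC hM
        (∃ _ : SymmetricCategory (OMDP A), ∀ X Y : OMDP A, (β_ X Y).hom = OMDP.swap X Y) ∧
        Nonempty (RigidCategory (OMDP A)) ∧
        ∀ X : OMDP A, ∃ _ : ExactPairing X X.dual,
          η_ X X.dual = OMDP.unit X ∧ ε_ X X.dual = OMDP.counit X :=
  ⟨OMDP.isCategory A, OMDP.isMonoidal A, ⟨OMDP.instSymmetric, fun _ _ => rfl⟩,
    ⟨OMDP.instRigid⟩, fun X => ⟨OMDP.instExactPairing X, rfl, rfl⟩⟩
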